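/- Let $L\subset\mathbb R^2$ be a lattice and let $\mathcal F$ be a hyperbolic automorphism of the torus $\mathbb T^2=\mathbb R^2/L$. A labelled bi-partition $\{R_1,R_2\}$ of $\mathbb T^2$ is given by linearly independent vectors $v$ ("horizontal"), $w$ ("vertical"), a base point $o$, and numbers $s_1,s_2,u_1,u_2>0$ such that $e=s_2v+u_1w$ and $f=-s_1v+u_2w$ generate $L$; in the affine coordinates $(x,y)\mapsto o+xv+yw$ its tiles are $R_1=[0,s_1]\times[0,u_1]$ and $R_2=[-s_2,0]\times[0,u_2]$, projected to $\mathbb T^2$, and its spines are $J^s=[-s_2,s_1]\times\{0\}$ and $J^u=\{0\}\times[0,u_1+u_2]$. It is a Berg partition for $\mathcal F$ if $v$ and $w$ span the stable and the unstable direction of $\mathcal F$, respectively, and $\mathcal F(J^s)\subset J^s$, $\mathcal F(J^u)\supset J^u$. Its connectivity matrix has as its $(i,j)$ entry the number of connected components of $\mathcal F(R_i^\circ)\cap R_j^\circ$, where $R_i^\circ$ is the open parallelogram of $R_i$. Two Berg partitions $\{Q_1,Q_2\}$ and $\{S_1,S_2\}$ for $\mathcal F$ are equivalent if there is an invertible affine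 map $\mathcal U$ of the torus with $\mathcal F\circ\mathcal U=\mathcal U\circ\mathcal F$ that carries the tile $Q_i$ (with its open parallelogram) onto $S_i$, $i=1,2$. Theorem. Let $F\in GL(2,\mathbb Z)$ have non-negative entries, and suppose that in some basis of $L$ the automorphism $\mathcal F$ is given by the matrix $F$ or by the matrix $-F$. Then the number of nonequivalent Berg partitions for $\mathcal F$ with the connectivity matrix $F^T$ is $\left[\frac{\sigma}{2}\right]$, where $\sigma$ is the sum of the entries of $F$ and $[\cdot]$ denotes the integer part. Moreover, for a Berg partition $P$ of $\mathcal F$ with connectivity matrix $F^T$ let $\mathcal S_P$ be the rotation of $\mathbb T^2$ by $\pi$ around the center of the vertical spine of $P$. There is a bijection from the equivalence classes of Berg partitions for $\mathcal F$ with connectivity matrix $F^T$ to the equivalence classes of Berg partitions for $-\mathcal F$ with connectivity matrix $F^T$ such that, for every $P$, there is a fixed point $q$ of $\mathcal F\circ\mathcal S_P$ in the vertical spine of $P$ for which the translate $P-q$ is a Berg partition for $-\mathcal F$ with connectivity matrix $F^T$, and the class of $P$ is mapped to the class of $P-q$. -/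

import Mathlib

noncomputable section

/-- The Cartesian plane. -/
abbrev Plane : Type := Fin 2 → ℝ

/-- An automorphism of the torus `Plane ⧸ L`, given by its linear lift to the plane, a linear
automorphism that maps the lattice `L` onto itself. -/
structure ToralAut (L : Submodule ℤ Plane) where
  /-- The linear lift. -/
  lin : Plane ≃ₗ[ℝ] Plane
  map_lattice : L.map (lin.restrictScalars ℤ).toLinearMap = L

namespace ToralAut

variable {L : Submodule ℤ Plane}

/-- The automorphism of the torus `Plane ⧸ L` induced by the linear lift. -/
def toTorus (A : ToralAut L) : (Plane ⧸ L) ≃ₗ[ℤ] (Plane ⧸ L) :=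
  Submodule.Quotient.equiv L L (A.lin.restrictScalars ℤ) A.map_lattice

theorem mem_iff (A : ToralAut L) (x : Plane) : A.lin x ∈ L ↔ x ∈ L := by
  constructor
  · intro h
    have h' : A.lin x ∈ L.map (A.lin.restrictScalars ℤ).toLinearMap := A.map_lattice.symm ▸ h
    obtain ⟨y, hy, hyx⟩ := h'
    have hxy : y = x := A.lin.injective hyx
    exact hxy ▸ hy
  · intro h
    exact A.map_lattice.le (Submodule.mem_map_of_mem (f := (A.lin.restrictScalars ℤ).toLinearMap) h)

/-- A linear automorphism of the plane that preserves membership in `L` in both directions. -/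
def ofMemIff (f : Plane ≃ₗ[ℝ] Plane) (h : ∀ x, f x ∈ L ↔ x ∈ L) : ToralAut L where
  lin := f
  map_lattice := by
    ext y
    constructor
    · rintro ⟨x, hx, rfl⟩
      exact (h x).2 hx
    · intro hy
      refine ⟨f.symm y, ?_, f.apply_symm_apply y⟩
      have := h (f.symm y)
      rw [f.apply_symm_apply] at this
      exact this.1 hy

/-- The identity automorphism. -/
def one : ToralAut L := ofMemIff (LinearEquiv.refl ℝ Plane) fun _ => Iff.rfl

/-- The composition `A ∘ B`. -/
def comp (A B : ToralAut L) : ToralAut L :=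
  ofMemIff (B.lin.trans A.lin) fun x => (A.mem_iff (B.lin x)).trans (B.mem_iff x)

/-- The inverse automorphism. -/
def inv (A : ToralAut L) : ToralAut L :=
  ofMemIff A.lin.symm fun x => by
    have := A.mem_iff (A.lin.symm x)
    rw [A.lin.apply_symm_apply] at this
    exact this.symm

/-- The automorphism `x ↦ -A x`. -/
instance : Neg (ToralAut L) :=
  ⟨fun A => ofMemIff (A.lin.trans (LinearEquiv.neg ℝ)) fun x => by
    simpa using A.mem_iff x⟩

theorem toTorus_mk (A : ToralAut L) (x : Plane) :
    A.toTorus (L.mkQ x) = L.mkQ (A.lin x) := rfl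

theorem neg_lin_apply (A : ToralAut L) (x : Plane) : (-A).lin x = -A.lin x := rfl

theorem one_toTorus (x : Plane ⧸ L) : (one : ToralAut L).toTorus x = x := by
  obtain ⟨y, rfl⟩ := L.mkQ_surjective x
  rfl

theorem comp_toTorus (A B : ToralAut L) (x : Plane ⧸ L) :
    (A.comp B).toTorus x = A.toTorus (B.toTorus x) := by
  obtain ⟨y, rfl⟩ := L.mkQ_surjective x
  rfl

theorem inv_toTorus (A : ToralAut L) (x : Plane ⧸ L) :
    A.toTorus (A.inv.toTorus x) = x := by
  obtain ⟨y, rfl⟩ := L.mkQ_surjective x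
  exact congrArg L.mkQ (A.lin.apply_symm_apply y)

/-- `A` is hyperbolic: its lift has no complex eigenvalue of modulus one. -/
def IsHyperbolic (A : ToralAut L) : Prop :=
  ∀ z : ℂ, ((LinearMap.charpoly (A.lin : Plane →ₗ[ℝ] Plane)).map (algebraMap ℝ ℂ)).IsRoot z →
    ‖z‖ ≠ 1

/-- `A` is given by the integer matrix `M` in the basis `b` of the lattice `L`
(the columns of `M` are the coordinates of the images of the basis vectors). -/
def IsGivenBy (A : ToralAut L) (b : Module.Basis (Fin 2) ℤ L) (M : Matrix (Fin 2) (Fin 2) ℤ) :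
    Prop :=
  ∀ j, A.lin (b j) = ∑ i, M i j • (b i : Plane)

end ToralAut

/-- A (labelled, arbitrarily placed) bi-partition of the torus `Plane ⧸ L` into two
parallelograms. In the affine coordinates `(x, y) ↦ o + x • v + y • w`, the two tiles are
`R₁ = [0, s₁] × [0, u₁]` and `R₂ = [-s₂, 0] × [0, u₂]`, and `L` is generated by
`e = (s₂, u₁)` and `f = (-s₁, u₂)`; the translates of the tiles by `L` then tile the plane.
The label `0 : Fin 2` stands for the first tile and `1 : Fin 2` for the second one. -/
structure Bipartition (L : Submodule ℤ Plane) where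
  /-- The base point, from which the two spines start. -/
  o : Plane
  /-- The horizontal direction. -/
  v : Plane
  /-- The vertical direction. -/
  w : Plane
  /-- The horizontal side lengths, in units of `v`. -/
  s : Fin 2 → ℝ
  /-- The vertical side lengths, in units of `w`. -/
  u : Fin 2 → ℝ
  indep : LinearIndependent ℝ ![v, w]
  s_pos : ∀ i, 0 < s i
  u_pos : ∀ i, 0 < u i
  span_eq : Submodule.span ℤ {s 1 • v + u 0 • w, -(s 0) • v + u 1 • w} = L

namespace Bipartition

variable {L : Submodule ℤ Plane} (P : Bipartition L)

/-- The point of the torus with affine coordinates `(x, y)`. -/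
def point (x y : ℝ) : Plane ⧸ L := L.mkQ (P.o + x • P.v + y • P.w)

/-- The (closed) parallelograms of the partition, as subsets of the torus. -/
def rect : Fin 2 → Set (Plane ⧸ L) :=
  ![Set.image2 P.point (Set.Icc 0 (P.s 0)) (Set.Icc 0 (P.u 0)),
    Set.image2 P.point (Set.Icc (-(P.s 1)) 0) (Set.Icc 0 (P.u 1))]

/-- The open parallelograms of the partition. (A closed parallelogram may touch itself along a
side in the torus, so this can be smaller than the topological interior of `P.rect i`.) -/
def inner : Fin 2 → Set (Plane ⧸ L) :=
  ![Set.image2 P.point (Set.Ioo 0 (P.s 0)) (Set.Ioo 0 (P.u 0)),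
    Set.image2 P.point (Set.Ioo (-(P.s 1)) 0) (Set.Ioo 0 (P.u 1))]

/-- The horizontal spine, `[-s₂, s₁] × {0}`. -/
def spineS : Set (Plane ⧸ L) := Set.image2 P.point (Set.Icc (-(P.s 1)) (P.s 0)) {0}

/-- The vertical spine, `{0} × [0, u₁ + u₂]`. -/
def spineU : Set (Plane ⧸ L) := Set.image2 P.point {0} (Set.Icc 0 (P.u 0 + P.u 1))

/-- The bi-partition is a Berg partition for the toral automorphism `A`: its sides are parallel
to the stable and the unstable direction of `A`, and `A (Jˢ) ⊆ Jˢ`, `A (Jᵘ) ⊇ Jᵘ`. -/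
structure IsBerg (A : ToralAut L) : Prop where
  stable : ∃ μ : ℝ, |μ| < 1 ∧ A.lin P.v = μ • P.v
  unstable : ∃ ν : ℝ, 1 < |ν| ∧ A.lin P.w = ν • P.w
  spineS_subset : A.toTorus '' P.spineS ⊆ P.spineS
  subset_spineU : P.spineU ⊆ A.toTorus '' P.spineU

/-- The connectivity matrix: the entry `(i, j)` is the number of connected components of the
intersection of the image of the `i`-th open parallelogram with the `j`-th one. -/
def connectivity (A : ToralAut L) : Matrix (Fin 2) (Fin 2) ℕ :=
  Matrix.of fun i j =>
    Nat.card (ConnectedComponents ↥(A.toTorus '' P.inner i ∩ P.inner j))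

/-- The rotation by `π` of the torus around the center of the vertical spine. -/
def rot (x : Plane ⧸ L) : Plane ⧸ L :=
  L.mkQ ((2 : ℝ) • (P.o + ((P.u 0 + P.u 1) / 2) • P.w)) - x

/-- The bi-partition translated by the vector `a`. -/
def translate (a : Plane) : Bipartition L := { P with o := P.o + a }

end Bipartition

/-- `U` is an invertible affine map of the torus. -/
def IsToralAffine {L : Submodule ℤ Plane} (U : Plane ⧸ L → Plane ⧸ L) : Prop :=
  ∃ (C : ToralAut L) (c : Plane ⧸ L), ∀ x, U x = C.toTorus x + c

/-- Two labelled bi-partitions are equivalent with respect to `A` if some toral affine map that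
commutes with `A` carries the `i`-th parallelogram, together with its open part, onto the `i`-th
parallelogram, for `i = 1, 2`. -/
def BergEquiv {L : Submodule ℤ Plane} (A : ToralAut L) (P Q : Bipartition L) : Prop :=
  ∃ U : Plane ⧸ L → Plane ⧸ L, IsToralAffine U ∧ (∀ x, A.toTorus (U x) = U (A.toTorus x)) ∧
    ∀ i, U '' P.rect i = Q.rect i ∧ U '' P.inner i = Q.inner i

namespace BergEquiv

variable {L : Submodule ℤ Plane} {A : ToralAut L} {P Q R : Bipartition L}

theorem refl (A : ToralAut L) (P : Bipartition L) : BergEquiv A P P :=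
  ⟨id, ⟨ToralAut.one, 0, fun x => by simp [ToralAut.one_toTorus]⟩, fun _ => rfl,
    fun i => ⟨Set.image_id _, Set.image_id _⟩⟩

theorem trans (h : BergEquiv A P Q) (h' : BergEquiv A Q R) : BergEquiv A P R := by
  obtain ⟨U, ⟨C, c, hU⟩, hc, hi⟩ := h
  obtain ⟨U', ⟨C', c', hU'⟩, hc', hi'⟩ := h'
  refine ⟨U' ∘ U, ⟨C'.comp C, C'.toTorus c + c', fun x => ?_⟩, fun x => ?_, fun i => ⟨?_, ?_⟩⟩
  · simp [hU, hU', ToralAut.comp_toTorus, add_assoc]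
  · simp [hc, hc']
  · rw [Set.image_comp, (hi i).1, (hi' i).1]
  · rw [Set.image_comp, (hi i).2, (hi' i).2]

theorem symm (h : BergEquiv A P Q) : BergEquiv A Q P := by
  obtain ⟨U, ⟨C, c, hU⟩, hc, hi⟩ := h
  have hinj : Function.Injective U := fun x y hxy => by
    rw [hU, hU] at hxy
    exact C.toTorus.injective (add_right_cancel hxy)
  let V : Plane ⧸ L → Plane ⧸ L := fun x => C.inv.toTorus x + C.inv.toTorus (-c)
  have hUV : ∀ x, U (V x) = x := fun x => by
    simp only [V, hU, map_add, ToralAut.inv_toTorus]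
    abel
  have hVU : ∀ x, V (U x) = x := fun x => hinj (hUV (U x))
  have him : ∀ S : Set (Plane ⧸ L), V '' (U '' S) = S := fun S => by
    rw [← Set.image_comp]
    have : V ∘ U = id := funext hVU
    rw [this, Set.image_id]
  refine ⟨V, ⟨C.inv, _, fun x => rfl⟩, fun x => hinj ?_, fun i => ⟨?_, ?_⟩⟩
  · rw [hUV, ← hc, hUV]
  · rw [← (hi i).1, him]
  · rw [← (hi i).2, him]

end BergEquiv

/-- The Berg partitions for `A` with the connectivity matrix `N`. -/
abbrev BergPartition {L : Submodule ℤ Plane} (A : ToralAut L) (N : Matrix (Fin 2) (Fin 2) ℤ) :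
    Type :=
  {P : Bipartition L // P.IsBerg A ∧ ∀ i j, (P.connectivity A i j : ℤ) = N i j}

/-- The equivalence relation on the Berg partitions for `A` with the connectivity matrix `N`. -/
def bergSetoid {L : Submodule ℤ Plane} (A : ToralAut L) (N : Matrix (Fin 2) (Fin 2) ℤ) :
    Setoid (BergPartition A N) where
  r P Q := BergEquiv A P.1 Q.1
  iseqv := ⟨fun P => BergEquiv.refl A P.1, BergEquiv.symm, BergEquiv.trans⟩

/-- The equivalence classes of Berg partitions for `A` with the connectivity matrix `N`. -/
abbrev BergClass {L : Submodule ℤ Plane} (A : ToralAut L) (N : Matrix (Fin 2) (Fin 2) ℤ) : Type :=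
  Quotient (bergSetoid A N)

/-- The equivalence class of a Berg partition. -/
def BergPartition.toClass {L : Submodule ℤ Plane} {A : ToralAut L}
    {N : Matrix (Fin 2) (Fin 2) ℤ} (P : BergPartition A N) : BergClass A N :=
  Quotient.mk (bergSetoid A N) P

end

/-!
Write a Berg partition `P` of the automorphism `A` in the coordinates `(x, y)` along its two sides.
There `A` is diagonal with a contracting eigenvalue `μ` and an expanding eigenvalue `ν`, and the
lattice is generated by `e = (s₂, u₁)` and `f = (-s₁, u₂)`; let `M` be the integer matrix of `A` in
the basis `(e, f)` (`Bipartition.Adapted`). Since no lattice point other than `0` lies on an axis,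
the Berg condition is equivalent to the existence of a lattice point `p` such that `A` moves the base
point horizontally by `X(p)`, equivalently vertically by `-Y(p)`, and the images of the spines,
displaced by these amounts, are nested as required (`Bipartition.Adapted.isBerg_iff`,
`Bipartition.Admissible`).

*Connectivity.* By the Markov property the image of a tile `Rᵢ` crosses a lattice translate of `Rⱼ`
along its whole width or not at all. So the components of the intersection are counted by the tiles
on a vertical segment whose ends lie above the horizontal spine through `0` and the one through the
image of `e` or `f`. Passing through a tile of the first kind adds `e` and through one of the second
kind adds `f`; hence the numbers of tiles are the coefficients of that image, and the connectivity
matrix is the transpose of `M` up to the sign of `ν` (`Bipartition.BergAt.connectivity_eq`). A Berg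
partition has connectivity matrix `Fᵀ` exactly if `M = F` or `M = -F`, the sign being that of `ν`.

*Equivalence.* Two Berg partitions with the same `M` have the same shape. An equivalence carries open
tiles to open tiles, so its linear part is, up to the identification of the shapes, `1` or `-1`; in
the second case it is the rotation about the center of the vertical spine, which preserves both tiles.
Comparing the displacements `p` and `p'` of the base points, the partitions are equivalent if and
only if `p = p'` or `p + p' = (M - 1)(e + f)` (`Bipartition.bergEquiv_of_eq`,
`Bipartition.bergEquiv_of_reflect`, `Bipartition.eq_or_reflect_of_bergEquiv`).

*Counting.* Let `M = F`, so that `ν > 0`. Two lattice points whose horizontal distance is less than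
`s₁ + s₂` differ by a vector whose coefficients have the same weak sign (`same_sign`). From this, the
sum of the coefficients maps the admissible lattice points bijectively onto `0, …, σ - 2`, and the
symmetry `p ↦ (M - 1)(e + f) - p` becomes `i ↦ σ - 2 - i`, which leaves `⌊σ / 2⌋` classes
(`BergPartition.card_class`). The shape itself is built from the Perron eigenvectors of `F`, and every
admissible point occurs since `A - 1` is invertible.

*From `A` to `-A`.* The fixed point `q` is the fixed point of the affine map induced on the line
through the vertical spine. Translation by `-q` turns `A ∘ S_P` into `-A` and the displacement `p`
into `p - M(e + f)`, whatever the choice of `q`. This shift intertwines the two descriptions of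
equivalence and is undone by the same construction for `-A`, so it is a bijection of the classes
(`BergPartition.exists_classEquiv_neg`). It also reduces the count for the matrix `-F` to that
for `F`.
-/

/-! ### Arithmetic of the lattice points near the axes -/

/-- A lattice point `m • e + n • f` whose horizontal coordinate is shorter than the horizontal
spine has coefficients of the same weak sign. This is the only combinatorial property of the
lattice behind the counts below. -/
theorem same_sign {a b : ℝ} (ha : 0 < a) (hb : 0 < b) {m n : ℤ}
    (h : |(m : ℝ) * b - n * a| < a + b) : (0 ≤ m ∧ 0 ≤ n) ∨ (m ≤ 0 ∧ n ≤ 0) := by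
  rw [abs_lt] at h
  by_contra hc
  have hc' : (m ≤ -1 ∧ 1 ≤ n) ∨ (1 ≤ m ∧ n ≤ -1) := by omega
  rcases hc' with ⟨h1, h2⟩ | ⟨h1, h2⟩
  · have h1' : (m : ℝ) ≤ -1 := by exact_mod_cast h1
    have h2' : (1 : ℝ) ≤ n := by exact_mod_cast h2
    nlinarith
  · have h1' : (1 : ℝ) ≤ m := by exact_mod_cast h1
    have h2' : (n : ℝ) ≤ -1 := by exact_mod_cast h2
    nlinarith

/-- The lattice points in the tiles of the first kind met by a vertical segment from `(x, 0)` to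
the height of the lattice point with coefficients `(k, l)` are indexed by their first
coefficient, which takes each value in `[0, k)` once. -/
theorem card_crossings {a b c d x : ℝ} (ha : 0 < a) (hb : 0 < b) (hc : 0 < c) (hd : 0 < d)
    {k l : ℤ} (h1 : -b < x) (h2 : x < a) (h3 : -b < x - (k * b - l * a))
    (h4 : x - (k * b - l * a) < a) (hY : 0 < k * c + l * d)
    (hgen : ∀ m n : ℤ, 0 ≤ m * c + n * d → m * c + n * d < k * c + l * d → x ≠ m * b - n * a) :
    0 ≤ k ∧ 0 ≤ l ∧
    (Nat.card {p : ℤ × ℤ // (0 < x - (p.1 * b - p.2 * a) ∧ x - (p.1 * b - p.2 * a) < a) ∧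
      -c < p.1 * c + p.2 * d ∧ p.1 * c + p.2 * d < k * c + l * d} : ℤ) = k := by
  have key0 : 0 ≤ k ∧ 0 ≤ l := by
    rcases same_sign ha hb (m := k) (n := l) (by rw [abs_lt]; constructor <;> linarith) with h | h
    · exact h
    · have hk : (k : ℝ) ≤ 0 := by exact_mod_cast h.1
      have hl : (l : ℝ) ≤ 0 := by exact_mod_cast h.2
      nlinarith
  refine ⟨key0.1, key0.2, ?_⟩
  -- a tile of the first kind at `(m, n)` crossed by the segment lies between the two ends
  have hfor : ∀ m n : ℤ, 0 < x - (m * b - n * a) → x - (m * b - n * a) < a →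
      -c < m * c + n * d → m * c + n * d < k * c + l * d → 0 ≤ m ∧ m < k := by
    intro m n g1 g2 g3 g4
    have hm : 0 ≤ m := by
      rcases same_sign ha hb (m := m) (n := n) (by rw [abs_lt]; constructor <;> linarith) with h | h
      · exact h.1
      · by_contra hm
        have hm' : (m : ℝ) ≤ -1 := by exact_mod_cast (by omega : m ≤ -1)
        have hn' : (n : ℝ) ≤ 0 := by exact_mod_cast h.2
        nlinarith
    refine ⟨hm, ?_⟩
    have hs := same_sign ha hb (m := k - m) (n := l - n)
      (by push_cast; rw [abs_lt]; constructor <;> linarith)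
    by_contra hk
    have hkm : k - m ≤ 0 := by omega
    have hkm' : (k : ℝ) - m ≤ 0 := by exact_mod_cast hkm
    have hln : 1 ≤ l - n := by
      by_contra hln
      have : (l : ℝ) - n ≤ 0 := by exact_mod_cast (by omega : l - n ≤ 0)
      nlinarith
    have hln' : (1 : ℝ) ≤ l - n := by exact_mod_cast hln
    have hkm0 : k = m := by omega
    subst hkm0
    nlinarith
  have hback : ∀ m n : ℤ, 0 ≤ m → m < k → 0 ≤ x - (m * b - n * a) → x - (m * b - n * a) < a →
      0 ≤ m * c + n * d ∧ m * c + n * d < k * c + l * d := by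
    intro m n hm hk g1 g2
    have hm' : (0 : ℝ) ≤ m := by exact_mod_cast hm
    have hk' : (1 : ℝ) ≤ k - m := by exact_mod_cast (by omega : 1 ≤ k - m)
    constructor
    · have hn : 0 ≤ n := by
        rcases same_sign ha hb (m := m) (n := n)
          (by rw [abs_lt]; constructor <;> linarith) with h | h
        · exact h.2
        · have hm0 : m = 0 := by omega
          subst hm0
          by_contra hn
          have hn' : (n : ℝ) ≤ -1 := by exact_mod_cast (by omega : n ≤ -1)
          push_cast at g1
          nlinarith
      have hn' : (0 : ℝ) ≤ n := by exact_mod_cast hn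
      positivity
    · have hs := same_sign ha hb (m := k - m) (n := l - n)
        (by push_cast; rw [abs_lt]; constructor <;> linarith)
      have hln : 0 ≤ l - n := by omega
      have hln' : (0 : ℝ) ≤ l - n := by exact_mod_cast hln
      nlinarith
  have hbij : Function.Bijective
      (fun p : {p : ℤ × ℤ // (0 < x - (p.1 * b - p.2 * a) ∧ x - (p.1 * b - p.2 * a) < a) ∧
        -c < p.1 * c + p.2 * d ∧ p.1 * c + p.2 * d < k * c + l * d} =>
      (⟨p.1.1, Set.mem_Ico.2 (hfor p.1.1 p.1.2 p.2.1.1 p.2.1.2 p.2.2.1 p.2.2.2)⟩ :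
        Set.Ico 0 k)) := by
    constructor
    · rintro ⟨⟨m, n⟩, ⟨g1, g2⟩, g3⟩ ⟨⟨m', n'⟩, ⟨g1', g2'⟩, g3'⟩ h
      have hm : m = m' := by simpa using h
      subst hm
      dsimp only at g1 g2 g1' g2'
      have hn : n = n' := by
        by_contra hne
        rcases (by omega : 1 ≤ n - n' ∨ 1 ≤ n' - n) with hh | hh
        · have : (1 : ℝ) ≤ n - n' := by exact_mod_cast hh
          nlinarith
        · have : (1 : ℝ) ≤ n' - n := by exact_mod_cast hh
          nlinarith
      subst hn
      rfl
    · rintro ⟨m, hm0, hmk⟩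
      obtain ⟨n, hn, -⟩ := existsUnique_add_zsmul_mem_Ico ha (x - m * b) 0
      simp only [zsmul_eq_mul, zero_add, Set.mem_Ico] at hn
      have g1 : 0 ≤ x - (m * b - n * a) := by linarith [hn.1]
      have g2 : x - (m * b - n * a) < a := by linarith [hn.2]
      obtain ⟨y1, y2⟩ := hback m n hm0 hmk g1 g2
      have g1' : 0 < x - (m * b - n * a) :=
        lt_of_le_of_ne g1 fun h => hgen m n y1 y2 (by linarith)
      exact ⟨⟨(m, n), ⟨g1', g2⟩, by linarith, y2⟩, rfl⟩
  rw [Nat.card_congr (Equiv.ofBijective _ hbij), Nat.card_eq_fintype_card,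
    Fintype.card_ofFinset, Int.card_Ico, sub_zero,
    Int.toNat_of_nonneg key0.1]

/-! ### Coordinates of a bi-partition -/

namespace Bipartition

variable {L : Submodule ℤ Plane} (P : Bipartition L)

/-- The horizontal coordinate of the lattice point `m • e + n • f`. -/
noncomputable def latX (m n : ℤ) : ℝ := m * P.s 1 - n * P.s 0

/-- The vertical coordinate of the lattice point `m • e + n • f`. -/
noncomputable def latY (m n : ℤ) : ℝ := m * P.u 0 + n * P.u 1

/-- The horizontal side of the `i`-th open parallelogram. -/
def side (i : Fin 2) : Set ℝ := ![Set.Ioo 0 (P.s 0), Set.Ioo (-(P.s 1)) 0] i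

theorem inner_eq (i : Fin 2) :
    P.inner i = Set.image2 P.point (P.side i) (Set.Ioo 0 (P.u i)) := by
  fin_cases i <;> rfl

theorem coord_ext {x y x' y' : ℝ} (h : x • P.v + y • P.w = x' • P.v + y' • P.w) :
    x = x' ∧ y = y' :=
  LinearIndependent.eq_of_pair P.indep h

theorem exists_coord (z : Plane) : ∃ x y : ℝ, z = x • P.v + y • P.w := by
  have hspan := P.indep.span_eq_top_of_card_eq_finrank' (by simp)
  have hz : z ∈ Submodule.span ℝ (Set.range ![P.v, P.w]) := hspan ▸ Submodule.mem_top
  rw [Matrix.range_cons, Matrix.range_cons, Matrix.range_empty, Set.union_empty,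
    Set.singleton_union, Submodule.mem_span_pair] at hz
  obtain ⟨x, y, h⟩ := hz
  exact ⟨x, y, h.symm⟩

theorem mem_lattice {x y : ℝ} :
    x • P.v + y • P.w ∈ L ↔ ∃ m n : ℤ, x = P.latX m n ∧ y = P.latY m n := by
  have key : ∀ m n : ℤ, m • (P.s 1 • P.v + P.u 0 • P.w) + n • (-(P.s 0) • P.v + P.u 1 • P.w) =
      P.latX m n • P.v + P.latY m n • P.w := by
    intro m n
    simp only [← Int.cast_smul_eq_zsmul ℝ, latX, latY]
    module
  have hL : x • P.v + y • P.w ∈ L ↔ x • P.v + y • P.w ∈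
      Submodule.span ℤ {P.s 1 • P.v + P.u 0 • P.w, -(P.s 0) • P.v + P.u 1 • P.w} :=
    iff_of_eq (congrArg (x • P.v + y • P.w ∈ ·) P.span_eq.symm)
  rw [hL, Submodule.mem_span_pair]
  constructor
  · rintro ⟨m, n, h⟩
    rw [key] at h
    exact ⟨m, n, (P.coord_ext h).1.symm, (P.coord_ext h).2.symm⟩
  · rintro ⟨m, n, rfl, rfl⟩
    exact ⟨m, n, key m n⟩

theorem point_eq_iff {x y x' y' : ℝ} :
    P.point x y = P.point x' y' ↔ ∃ m n : ℤ, x - x' = P.latX m n ∧ y - y' = P.latY m n := by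
  rw [← P.mem_lattice, point, point, Submodule.mkQ_apply, Submodule.mkQ_apply,
    Submodule.Quotient.eq]
  have : P.o + x • P.v + y • P.w - (P.o + x' • P.v + y' • P.w) =
      (x - x') • P.v + (y - y') • P.w := by module
  rw [this]

theorem exists_point (z : Plane ⧸ L) : ∃ x y : ℝ, z = P.point x y := by
  obtain ⟨z, rfl⟩ := L.mkQ_surjective z
  obtain ⟨x, y, h⟩ := P.exists_coord (z - P.o)
  refine ⟨x, y, ?_⟩
  rw [point, add_assoc, ← h, add_sub_cancel]

theorem latX_sub (m n m' n' : ℤ) : P.latX (m - m') (n - n') = P.latX m n - P.latX m' n' := by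
  simp only [latX]; push_cast; ring

theorem latY_sub (m n m' n' : ℤ) : P.latY (m - m') (n - n') = P.latY m n - P.latY m' n' := by
  simp only [latY]; push_cast; ring

theorem latX_add (m n m' n' : ℤ) : P.latX (m + m') (n + n') = P.latX m n + P.latX m' n' := by
  simp only [latX]; push_cast; ring

theorem latY_add (m n m' n' : ℤ) : P.latY (m + m') (n + n') = P.latY m n + P.latY m' n' := by
  simp only [latY]; push_cast; ring

theorem lat_same_sign {m n : ℤ} (h : |P.latX m n| < P.s 0 + P.s 1) :
    (0 ≤ m ∧ 0 ≤ n) ∨ (m ≤ 0 ∧ n ≤ 0) :=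
  same_sign (P.s_pos 0) (P.s_pos 1) h

theorem latY_nonneg {m n : ℤ} (hm : 0 ≤ m) (hn : 0 ≤ n) : 0 ≤ P.latY m n := by
  have h1 : (0 : ℝ) ≤ m := by exact_mod_cast hm
  have h2 : (0 : ℝ) ≤ n := by exact_mod_cast hn
  have := P.u_pos 0
  have := P.u_pos 1
  unfold latY
  positivity

theorem latY_nonpos {m n : ℤ} (hm : m ≤ 0) (hn : n ≤ 0) : P.latY m n ≤ 0 := by
  have h1 : (m : ℝ) ≤ 0 := by exact_mod_cast hm
  have h2 : (n : ℝ) ≤ 0 := by exact_mod_cast hn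
  have := P.u_pos 0
  have := P.u_pos 1
  unfold latY
  nlinarith

theorem eq_zero_of_same_sign {m n : ℤ} (h : (0 ≤ m ∧ 0 ≤ n) ∨ (m ≤ 0 ∧ n ≤ 0))
    (hY : P.latY m n = 0) : m = 0 ∧ n = 0 := by
  have h0 := P.u_pos 0
  have h1 := P.u_pos 1
  unfold latY at hY
  rcases h with ⟨hm, hn⟩ | ⟨hm, hn⟩
  · have hm' : (0 : ℝ) ≤ m := by exact_mod_cast hm
    have hn' : (0 : ℝ) ≤ n := by exact_mod_cast hn
    have e1 : (m : ℝ) * P.u 0 = 0 := by nlinarith [mul_nonneg hm' h0.le, mul_nonneg hn' h1.le]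
    have e2 : (n : ℝ) * P.u 1 = 0 := by nlinarith
    exact ⟨by simpa [h0.ne'] using e1, by simpa [h1.ne'] using e2⟩
  · have hm' : (m : ℝ) ≤ 0 := by exact_mod_cast hm
    have hn' : (n : ℝ) ≤ 0 := by exact_mod_cast hn
    have e1 : (m : ℝ) * P.u 0 = 0 := by
      nlinarith [mul_nonneg (neg_nonneg.2 hm') h0.le, mul_nonneg (neg_nonneg.2 hn') h1.le]
    have e2 : (n : ℝ) * P.u 1 = 0 := by nlinarith
    exact ⟨by simpa [h0.ne'] using e1, by simpa [h1.ne'] using e2⟩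

/-- The lattice translates of the vertical spine avoid the open tiles: a translate whose horizontal
position lies inside the `i`-th tile does not reach it vertically. -/
theorem not_spine_of_mem_side {i : Fin 2} {m n : ℤ} (hX : P.latX m n ∈ P.side i)
    (h1 : -(P.u 0 + P.u 1) < P.latY m n) (h2 : P.latY m n < P.u i) : False := by
  have a0 := P.s_pos 0
  have a1 := P.s_pos 1
  have b0 := P.u_pos 0
  have b1 := P.u_pos 1
  have hs : |P.latX m n| < P.s 0 + P.s 1 := by
    fin_cases i <;> simp only [side, Fin.zero_eta, Fin.mk_one, Matrix.cons_val_zero,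
      Matrix.cons_val_one, Set.mem_Ioo] at hX <;> rw [abs_lt] <;> constructor <;> linarith
  have hcases : (m = 0 ∧ 1 ≤ n) ∨ (1 ≤ m ∧ n = 0) ∨ (1 ≤ m ∧ 1 ≤ n) ∨ (m = 0 ∧ n = 0) ∨
      (m = 0 ∧ n ≤ -1) ∨ (m ≤ -1 ∧ n = 0) ∨ (m ≤ -1 ∧ n ≤ -1) := by
    have := P.lat_same_sign hs
    omega
  unfold latX at hX
  unfold latY at h1 h2
  fin_cases i <;> simp only [side, Fin.zero_eta, Fin.mk_one, Matrix.cons_val_zero,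
      Matrix.cons_val_one, Set.mem_Ioo] at hX h2 <;>
    rcases hcases with ⟨h, h'⟩ | ⟨h, h'⟩ | ⟨h, h'⟩ | ⟨h, h'⟩ | ⟨h, h'⟩ | ⟨h, h'⟩ | ⟨h, h'⟩ <;>
    (try subst h) <;> (try subst h') <;> (try push_cast at hX h1 h2) <;>
    (try rify at h) <;> (try rify at h') <;> nlinarith

/-- The open tiles embed into the torus. -/
theorem side_injective {i : Fin 2} {m n : ℤ} {x x' y y' : ℝ} (hx : x ∈ P.side i)
    (hx' : x' ∈ P.side i) (hy : y ∈ Set.Ioo 0 (P.u i)) (hy' : y' ∈ Set.Ioo 0 (P.u i))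
    (hX : x - x' = P.latX m n) (hY : y - y' = P.latY m n) : m = 0 ∧ n = 0 := by
  have a0 := P.s_pos 0
  have a1 := P.s_pos 1
  have b0 := P.u_pos 0
  have b1 := P.u_pos 1
  have hs : |P.latX m n| < P.s 0 + P.s 1 := by
    rw [← hX]
    fin_cases i <;> simp only [side, Fin.zero_eta, Fin.mk_one, Matrix.cons_val_zero,
      Matrix.cons_val_one, Set.mem_Ioo] at hx hx' <;> rw [abs_lt] <;> constructor <;> linarith
  have hcases : (m = 0 ∧ 1 ≤ n) ∨ (1 ≤ m ∧ n = 0) ∨ (1 ≤ m ∧ 1 ≤ n) ∨ (m = 0 ∧ n = 0) ∨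
      (m = 0 ∧ n ≤ -1) ∨ (m ≤ -1 ∧ n = 0) ∨ (m ≤ -1 ∧ n ≤ -1) := by
    have := P.lat_same_sign hs
    omega
  by_contra hne
  unfold latX at hX
  unfold latY at hY
  fin_cases i <;> simp only [side, Fin.zero_eta, Fin.mk_one, Matrix.cons_val_zero,
      Matrix.cons_val_one, Set.mem_Ioo] at hx hx' hy hy' <;>
    rcases hcases with ⟨h, h'⟩ | ⟨h, h'⟩ | ⟨h, h'⟩ | ⟨h, h'⟩ | ⟨h, h'⟩ | ⟨h, h'⟩ | ⟨h, h'⟩ <;>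
    first
    | exact hne ⟨h, h'⟩
    | (try subst h); (try subst h'); (try push_cast at hX hY); (try rify at h)
      (try rify at h'); nlinarith

end Bipartition

/-! ### The algebraic form of the Berg condition -/

namespace Bipartition

variable {L : Submodule ℤ Plane}

/-- The sides of `P` are eigenvectors of `A`, with a contracting eigenvalue `μ` in the horizontal
and an expanding eigenvalue `ν` in the vertical direction, and `M` is the matrix of `A` in the
basis `(e, f)` of the lattice that belongs to `P`. -/
structure Adapted (P : Bipartition L) (A : ToralAut L) (μ ν : ℝ)
    (M : Matrix (Fin 2) (Fin 2) ℤ) : Prop where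
  abs_lt : |μ| < 1
  lt_abs : 1 < |ν|
  lin_v : A.lin P.v = μ • P.v
  lin_w : A.lin P.w = ν • P.w
  X_map : ∀ m n, P.latX (M 0 0 * m + M 0 1 * n) (M 1 0 * m + M 1 1 * n) = μ * P.latX m n
  Y_map : ∀ m n, P.latY (M 0 0 * m + M 0 1 * n) (M 1 0 * m + M 1 1 * n) = ν * P.latY m n
  surj : ∀ m n, ∃ m' n', P.latX m n = μ * P.latX m' n' ∧ P.latY m n = ν * P.latY m' n'

/-- The conditions on a lattice point `m • e + n • f` under which it can be the displacement of
the base point of a Berg partition: the affine images of the two spines, displaced by its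
horizontal and its vertical coordinate, are nested as required. -/
structure Admissible (P : Bipartition L) (μ ν : ℝ) (m n : ℤ) : Prop where
  stable : ∀ x ∈ Set.Icc (-(P.s 1)) (P.s 0), μ * x + P.latX m n ∈ Set.Icc (-(P.s 1)) (P.s 0)
  unstable : ∀ y ∈ Set.Icc 0 (P.u 0 + P.u 1), ∃ y' ∈ Set.Icc 0 (P.u 0 + P.u 1),
    y + P.latY m n = ν * y'

/-- The base point of `P` is moved by `A` along the horizontal spine by the horizontal coordinate
of the admissible lattice point `m • e + n • f`, which in the torus is the same as a
displacement by minus its vertical coordinate. -/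
structure BergAt (P : Bipartition L) (A : ToralAut L) (μ ν : ℝ) (m n : ℤ) : Prop where
  disp : A.toTorus (P.point 0 0) = P.point (P.latX m n) 0
  adm : P.Admissible μ ν m n

variable {P : Bipartition L} {A : ToralAut L} {μ ν : ℝ} {M : Matrix (Fin 2) (Fin 2) ℤ}

theorem toTorus_point (hv : A.lin P.v = μ • P.v) (hw : A.lin P.w = ν • P.w) {ξ η : ℝ}
    (h : A.toTorus (P.point 0 0) = P.point ξ η) (x y : ℝ) :
    A.toTorus (P.point x y) = P.point (μ * x + ξ) (ν * y + η) := by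
  unfold point at *
  rw [ToralAut.toTorus_mk] at *
  have e1 : A.lin (P.o + x • P.v + y • P.w) =
      A.lin (P.o + (0 : ℝ) • P.v + (0 : ℝ) • P.w) + ((μ * x) • P.v + (ν * y) • P.w) := by
    simp only [map_add, map_smul, hv, hw]
    module
  rw [e1, map_add, h, ← map_add]
  congr 1
  module

theorem BergAt.toTorus_point {m n : ℤ} (hB : P.BergAt A μ ν m n) (hP : P.Adapted A μ ν M)
    (x y : ℝ) :
    A.toTorus (P.point x y) = P.point (μ * x + P.latX m n) (ν * y) := by
  simpa using Bipartition.toTorus_point hP.lin_v hP.lin_w hB.disp x y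

namespace Adapted

theorem μ_ne (hP : P.Adapted A μ ν M) : μ ≠ 0 := by
  rintro rfl
  have h := hP.lin_v
  rw [zero_smul, LinearEquiv.map_eq_zero_iff] at h
  exact P.indep.ne_zero 0 h

theorem ν_ne (hP : P.Adapted A μ ν M) : ν ≠ 0 := by
  rintro rfl
  have := hP.lt_abs
  norm_num at this

/-- The stable line contains no lattice point: the automorphism would shrink or enlarge the
integer coefficients of such a point by the factor `ν`, against which there is an infinite
descent. -/
theorem latX_eq_zero (hP : P.Adapted A μ ν M) {m n : ℤ} (h : P.latX m n = 0) :
    m = 0 ∧ n = 0 := by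
  have a0 := P.s_pos 0
  have a1 := P.s_pos 1
  have b0 := P.u_pos 0
  have b1 := P.u_pos 1
  have hD : 0 < P.u 0 * P.s 0 + P.u 1 * P.s 1 := by positivity
  have hid : ∀ m n : ℤ, P.latX m n = 0 →
      m * (P.u 0 * P.s 0 + P.u 1 * P.s 1) = P.s 0 * P.latY m n := by
    intro m n h
    unfold latX at h
    unfold latY
    linear_combination P.u 1 * h
  have hmain : ∀ k : ℕ, ∀ m n : ℤ, m.natAbs = k → P.latX m n = 0 → m = 0 := by
    intro k
    induction k using Nat.strong_induction_on with
    | _ k ih =>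
      intro m n hk h
      by_contra hm
      obtain ⟨m', n', hx, hy⟩ := hP.surj m n
      have hx' : P.latX m' n' = 0 := by
        rw [h] at hx
        exact (mul_eq_zero.1 hx.symm).resolve_left hP.μ_ne
      have e : (m : ℝ) = ν * m' := by
        have h1 := hid m n h
        have h2 := hid m' n' hx'
        apply mul_right_cancel₀ hD.ne'
        rw [h1, hy, mul_assoc, h2]
        ring
      have hm' : m' ≠ 0 := by
        rintro rfl
        apply hm
        exact_mod_cast (by simpa using e : (m : ℝ) = 0)
      have hlt : m'.natAbs < k := by
        rw [← hk]
        have : (|m'| : ℝ) < |(m : ℝ)| := by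
          rw [e, abs_mul]
          have : 0 < |(m' : ℝ)| := by positivity
          nlinarith [hP.lt_abs]
        zify
        exact_mod_cast this
      exact hm' (ih _ hlt m' n' rfl hx')
  have hm := hmain _ m n rfl h
  subst hm
  refine ⟨rfl, ?_⟩
  unfold latX at h
  simpa [a0.ne'] using h

theorem latY_eq_zero (hP : P.Adapted A μ ν M) {m n : ℤ} (h : P.latY m n = 0) :
    m = 0 ∧ n = 0 := by
  have a0 := P.s_pos 0
  have a1 := P.s_pos 1
  have b0 := P.u_pos 0
  have b1 := P.u_pos 1
  have hD : 0 < P.u 0 * P.s 0 + P.u 1 * P.s 1 := by positivity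
  have hid : ∀ m n : ℤ, P.latY m n = 0 →
      m * (P.u 0 * P.s 0 + P.u 1 * P.s 1) = P.u 1 * P.latX m n := by
    intro m n h
    unfold latY at h
    unfold latX
    linear_combination P.s 0 * h
  have hmain : ∀ k : ℕ, ∀ m n : ℤ, m.natAbs = k → P.latY m n = 0 → m = 0 := by
    intro k
    induction k using Nat.strong_induction_on with
    | _ k ih =>
      intro m n hk h
      by_contra hm
      have hx := hP.X_map m n
      have hy := hP.Y_map m n
      set m' := M 0 0 * m + M 0 1 * n
      set n' := M 1 0 * m + M 1 1 * n
      rw [h, mul_zero] at hy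
      have e : (m' : ℝ) = μ * m := by
        have h1 := hid m n h
        have h2 := hid m' n' hy
        apply mul_right_cancel₀ hD.ne'
        rw [h2, hx, mul_assoc, h1]
        ring
      have hm' : m' ≠ 0 := by
        intro h0
        rw [h0, Int.cast_zero, eq_comm, mul_eq_zero, or_iff_right hP.μ_ne] at e
        exact hm (by exact_mod_cast e)
      have hlt : m'.natAbs < k := by
        rw [← hk]
        have : (|m'| : ℝ) < |(m : ℝ)| := by
          rw [e, abs_mul]
          have : 0 < |(m : ℝ)| := by positivity
          nlinarith [hP.abs_lt]
        zify
        exact_mod_cast this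
      exact hm' (ih _ hlt m' n' rfl hy)
  have hm := hmain _ m n rfl h
  subst hm
  refine ⟨rfl, ?_⟩
  unfold latY at h
  simpa [b1.ne'] using h

theorem latX_inj (hP : P.Adapted A μ ν M) {m n m' n' : ℤ} (h : P.latX m n = P.latX m' n') :
    m = m' ∧ n = n' := by
  have := hP.latX_eq_zero (m := m - m') (n := n - n') (by rw [latX_sub, h, sub_self])
  omega

theorem latY_inj (hP : P.Adapted A μ ν M) {m n m' n' : ℤ} (h : P.latY m n = P.latY m' n') :
    m = m' ∧ n = n' := by
  have := hP.latY_eq_zero (m := m - m') (n := n - n') (by rw [latY_sub, h, sub_self])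
  omega

theorem point_left_inj (hP : P.Adapted A μ ν M) {x x' y : ℝ} (h : P.point x y = P.point x' y) :
    x = x' := by
  obtain ⟨m, n, hx, hy⟩ := P.point_eq_iff.1 h
  obtain ⟨rfl, rfl⟩ := hP.latY_eq_zero (by rw [← hy, sub_self])
  rw [← sub_eq_zero, hx]
  simp [latX]

theorem point_right_inj (hP : P.Adapted A μ ν M) {x y y' : ℝ} (h : P.point x y = P.point x y') :
    y = y' := by
  obtain ⟨m, n, hx, hy⟩ := P.point_eq_iff.1 h
  obtain ⟨rfl, rfl⟩ := hP.latX_eq_zero (by rw [← hx, sub_self])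
  rw [← sub_eq_zero, hy]
  simp [latY]

theorem neg (hP : P.Adapted A μ ν M) : P.Adapted (-A) (-μ) (-ν) (-M) where
  abs_lt := by rw [abs_neg]; exact hP.abs_lt
  lt_abs := by rw [abs_neg]; exact hP.lt_abs
  lin_v := by rw [ToralAut.neg_lin_apply, hP.lin_v, neg_smul]
  lin_w := by rw [ToralAut.neg_lin_apply, hP.lin_w, neg_smul]
  X_map m n := by
    rw [neg_mul, ← hP.X_map]
    simp only [latX, Matrix.neg_apply]
    push_cast
    ring
  Y_map m n := by
    rw [neg_mul, ← hP.Y_map]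
    simp only [latY, Matrix.neg_apply]
    push_cast
    ring
  surj m n := by
    obtain ⟨m', n', h1, h2⟩ := hP.surj m n
    refine ⟨-m', -n', ?_, ?_⟩
    · rw [h1]; simp only [latX]; push_cast; ring
    · rw [h2]; simp only [latY]; push_cast; ring

theorem move (hP : P.Adapted A μ ν M) (a : Plane) :
    ({P with o := a} : Bipartition L).Adapted A μ ν M :=
  ⟨hP.abs_lt, hP.lt_abs, hP.lin_v, hP.lin_w, hP.X_map, hP.Y_map, hP.surj⟩

/-- In coordinates, `A` maps lattice points to lattice points. -/
theorem exists_mat (hv : A.lin P.v = μ • P.v) (hw : A.lin P.w = ν • P.w) (m n : ℤ) :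
    ∃ m' n', P.latX m' n' = μ * P.latX m n ∧ P.latY m' n' = ν * P.latY m n := by
  have h : P.latX m n • P.v + P.latY m n • P.w ∈ L := P.mem_lattice.2 ⟨m, n, rfl, rfl⟩
  have h' := (A.mem_iff _).2 h
  rw [map_add, map_smul, map_smul, hv, hw, smul_smul, smul_smul] at h'
  obtain ⟨m', n', h1, h2⟩ := P.mem_lattice.1 h'
  exact ⟨m', n', by rw [← h1, mul_comm], by rw [← h2, mul_comm]⟩

theorem surj_of_eigen (hv : A.lin P.v = μ • P.v) (hw : A.lin P.w = ν • P.w) (m n : ℤ) :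
    ∃ m' n', P.latX m n = μ * P.latX m' n' ∧ P.latY m n = ν * P.latY m' n' := by
  have h : P.latX m n • P.v + P.latY m n • P.w ∈ L := P.mem_lattice.2 ⟨m, n, rfl, rfl⟩
  obtain ⟨x, y, hxy⟩ := P.exists_coord (A.lin.symm (P.latX m n • P.v + P.latY m n • P.w))
  have hmem : x • P.v + y • P.w ∈ L := by
    rw [← hxy, ← A.mem_iff, LinearEquiv.apply_symm_apply]
    exact h
  rw [LinearEquiv.symm_apply_eq, map_add, map_smul, map_smul, hv, hw, smul_smul, smul_smul] at hxy
  obtain ⟨m', n', h1, h2⟩ := P.mem_lattice.1 hmem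
  obtain ⟨e1, e2⟩ := P.coord_ext hxy
  exact ⟨m', n', by rw [e1, h1, mul_comm], by rw [e2, h2, mul_comm]⟩

end Adapted

theorem IsBerg.exists_adapted (h : P.IsBerg A) : ∃ μ ν M, P.Adapted A μ ν M := by
  obtain ⟨μ, hμ, hv⟩ := h.stable
  obtain ⟨ν, hν, hw⟩ := h.unstable
  obtain ⟨a, c, h1, h2⟩ := Adapted.exists_mat hv hw 1 0
  obtain ⟨b, d, h3, h4⟩ := Adapted.exists_mat hv hw 0 1
  refine ⟨μ, ν, !![a, b; c, d], hμ, hν, hv, hw, fun m n => ?_, fun m n => ?_,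
    Adapted.surj_of_eigen hv hw⟩
  · simp only [latX, Matrix.of_apply, Matrix.cons_val', Matrix.cons_val_zero, Matrix.cons_val_one,
      Matrix.cons_val_fin_one] at *
    push_cast at *
    linear_combination (m : ℝ) * h1 + (n : ℝ) * h3
  · simp only [latY, Matrix.of_apply, Matrix.cons_val', Matrix.cons_val_zero, Matrix.cons_val_one,
      Matrix.cons_val_fin_one] at *
    push_cast at *
    linear_combination (m : ℝ) * h2 + (n : ℝ) * h4

theorem Adapted.isBerg_iff (hP : P.Adapted A μ ν M) :
    P.IsBerg A ↔ ∃ m n, P.BergAt A μ ν m n := by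
  have a0 := P.s_pos 0
  have a1 := P.s_pos 1
  have b0 := P.u_pos 0
  have b1 := P.u_pos 1
  constructor
  · intro h
    have hs : ∀ x ∈ Set.Icc (-(P.s 1)) (P.s 0), ∃ x' ∈ Set.Icc (-(P.s 1)) (P.s 0),
        A.toTorus (P.point x 0) = P.point x' 0 := by
      intro x hx
      obtain ⟨x', hx', y, hy, he⟩ := h.spineS_subset ⟨_, ⟨x, hx, 0, rfl, rfl⟩, rfl⟩
      rw [Set.mem_singleton_iff] at hy
      subst hy
      exact ⟨x', hx', he.symm⟩
    have hu : ∀ y ∈ Set.Icc 0 (P.u 0 + P.u 1), ∃ y' ∈ Set.Icc 0 (P.u 0 + P.u 1),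
        P.point 0 y = A.toTorus (P.point 0 y') := by
      intro y hy
      obtain ⟨z, ⟨x, hx, y', hy', rfl⟩, he⟩ := h.subset_spineU ⟨0, rfl, y, hy, rfl⟩
      rw [Set.mem_singleton_iff] at hx
      subst hx
      exact ⟨y', hy', he.symm⟩
    obtain ⟨ξ, hξ, hd⟩ := hs 0 ⟨by linarith, a0.le⟩
    have hpt := fun x y => Bipartition.toTorus_point hP.lin_v hP.lin_w hd x y
    obtain ⟨η, hη, hd'⟩ := hu 0 ⟨le_rfl, by linarith⟩
    rw [hpt, eq_comm, point_eq_iff] at hd'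
    obtain ⟨m, n, hX, hY⟩ := hd'
    have hX' : ξ = P.latX m n := by rw [← hX]; ring
    have hY' : ν * η = P.latY m n := by rw [← hY]; ring
    subst hX'
    refine ⟨m, n, hd, fun x hx => ?_, fun y hy => ?_⟩
    · obtain ⟨x', hx', he⟩ := hs x hx
      rw [hpt, mul_zero, add_zero] at he
      rw [hP.point_left_inj he]
      exact hx'
    · obtain ⟨y', hy', he⟩ := hu y hy
      rw [hpt] at he
      have he2 : P.point 0 (y + P.latY m n) = P.point 0 (ν * y') := by
        obtain ⟨m', n', g1, g2⟩ := P.point_eq_iff.1 he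
        refine P.point_eq_iff.2 ⟨m' + m, n' + n, ?_, ?_⟩
        · rw [latX_add, ← g1]; ring
        · rw [latY_add, ← g2]; ring
      exact ⟨y', hy', hP.point_right_inj he2⟩
  · rintro ⟨m, n, hB⟩
    have hpt := hB.toTorus_point hP
    refine ⟨⟨μ, hP.abs_lt, hP.lin_v⟩, ⟨ν, hP.lt_abs, hP.lin_w⟩, ?_, ?_⟩
    · rintro _ ⟨_, ⟨x, hx, y, rfl, rfl⟩, rfl⟩
      exact ⟨_, hB.adm.stable x hx, 0, rfl, by rw [hpt, mul_zero]⟩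
    · rintro _ ⟨x, rfl, y, hy, rfl⟩
      obtain ⟨y', hy', he⟩ := hB.adm.unstable y hy
      refine ⟨_, ⟨0, rfl, y', hy', rfl⟩, ?_⟩
      rw [hpt, point_eq_iff]
      exact ⟨m, n, by ring, by rw [← he]; ring⟩

/-- The set of admissible points is symmetric: the reflection `p ↦ (M - 1)(e + f) - p` comes from
the half-turn of `P` about the center of its vertical spine. -/
theorem Adapted.adm_reflect (hP : P.Adapted A μ ν M) {m n : ℤ} (h : P.Admissible μ ν m n) :
    P.Admissible μ ν (M 0 0 + M 0 1 - 1 - m) (M 1 0 + M 1 1 - 1 - n) := by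
  have hX := hP.X_map 1 1
  have hY := hP.Y_map 1 1
  simp only [latX, latY, mul_one] at hX hY
  push_cast at hX hY
  constructor
  · intro x hx
    have := h.stable (P.s 0 - P.s 1 - x) ⟨by linarith [hx.2], by linarith [hx.1]⟩
    simp only [latX, Set.mem_Icc] at this ⊢
    push_cast
    constructor <;> linarith
  · intro y hy
    obtain ⟨y', hy', he⟩ := h.unstable (P.u 0 + P.u 1 - y)
      ⟨by linarith [hy.2], by linarith [hy.1]⟩
    refine ⟨P.u 0 + P.u 1 - y', ⟨by linarith [hy'.2], by linarith [hy'.1]⟩, ?_⟩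
    simp only [latY] at he ⊢
    push_cast
    linarith

/-- Passing from `A` to `-A` shifts the admissible points by the image of `e + f`. -/
theorem Adapted.adm_neg (hP : P.Adapted A μ ν M) {m n : ℤ} (h : P.Admissible μ ν m n) :
    P.Admissible (-μ) (-ν) (m - (M 0 0 + M 0 1)) (n - (M 1 0 + M 1 1)) := by
  have hX := hP.X_map 1 1
  have hY := hP.Y_map 1 1
  simp only [latX, latY, mul_one] at hX hY
  push_cast at hX hY
  constructor
  · intro x hx
    have := h.stable (P.s 0 - P.s 1 - x) ⟨by linarith [hx.2], by linarith [hx.1]⟩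
    simp only [latX, Set.mem_Icc] at this ⊢
    push_cast
    constructor <;> linarith
  · intro y hy
    obtain ⟨y', hy', he⟩ := h.unstable y hy
    refine ⟨P.u 0 + P.u 1 - y', ⟨by linarith [hy'.2], by linarith [hy'.1]⟩, ?_⟩
    simp only [latY] at he ⊢
    push_cast
    linarith

end Bipartition

/-! ### Passing from `A` to `-A` -/

namespace Bipartition

variable {L : Submodule ℤ Plane} {P Q : Bipartition L} {A : ToralAut L} {μ ν : ℝ}
  {M : Matrix (Fin 2) (Fin 2) ℤ}

/-- The translate by a fixed point `q` of `A ∘ S_P` is a Berg partition for `-A`, since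
`A (S_P x) = -A (x - q) + q` and `S_P` preserves the two spines. -/
theorem BergAt.translate (hP : P.Adapted A μ ν M) {m n : ℤ} (hB : P.BergAt A μ ν m n)
    {q : Plane} (hq : A.toTorus (P.rot (L.mkQ q)) = L.mkQ q) :
    (P.translate (-q)).BergAt (-A) (-μ) (-ν) (m - (M 0 0 + M 0 1)) (n - (M 1 0 + M 1 1)) := by
  obtain ⟨h1, h2⟩ := hP.adm_neg hB.adm
  refine ⟨?_, h1, h2⟩
  have hX := hP.X_map 1 1
  have hY := hP.Y_map 1 1
  simp only [mul_one] at hX hY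
  -- the displacement of the base point changes by the vertical vector `ν (u₀ + u₁) w`, which is
  -- congruent to a horizontal one
  have hmem : -(ν * P.latY 1 1) • P.w - (μ * P.latX 1 1) • P.v ∈ L := by
    have := P.mem_lattice.2 ⟨-(M 0 0 + M 0 1), -(M 1 0 + M 1 1), rfl, rfl⟩
    convert this using 1
    have e1 : P.latX (-(M 0 0 + M 0 1)) (-(M 1 0 + M 1 1)) = -(μ * P.latX 1 1) := by
      rw [← hX]; simp only [latX]; push_cast; ring
    have e2 : P.latY (-(M 0 0 + M 0 1)) (-(M 1 0 + M 1 1)) = -(ν * P.latY 1 1) := by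
      rw [← hY]; simp only [latY]; push_cast; ring
    rw [e1, e2]
    module
  have hd' : A.lin P.o - (P.o + P.latX m n • P.v) ∈ L := by
    have hd := hB.disp
    simp only [point, zero_smul, add_zero] at hd
    exact (Submodule.Quotient.eq L).1 hd
  have hq' : A.lin ((2 : ℝ) • (P.o + ((P.u 0 + P.u 1) / 2) • P.w) - q) - q ∈ L := by
    unfold rot at hq
    rw [← map_sub, ToralAut.toTorus_mk, Submodule.mkQ_apply, Submodule.mkQ_apply,
      Submodule.Quotient.eq] at hq
    exact hq
  have hX' : P.latX (m - (M 0 0 + M 0 1)) (n - (M 1 0 + M 1 1)) =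
      P.latX m n - μ * P.latX 1 1 := by rw [latX_sub, hX]
  have hY1 : P.latY 1 1 = P.u 0 + P.u 1 := by simp [latY]
  change (-A).toTorus (L.mkQ (P.o + -q + (0 : ℝ) • P.v + (0 : ℝ) • P.w)) =
    L.mkQ (P.o + -q + P.latX (m - (M 0 0 + M 0 1)) (n - (M 1 0 + M 1 1)) • P.v + (0 : ℝ) • P.w)
  rw [ToralAut.toTorus_mk, Submodule.mkQ_apply, Submodule.mkQ_apply, Submodule.Quotient.eq, hX']
  convert L.sub_mem (L.sub_mem hd' hq') hmem using 1
  simp only [ToralAut.neg_lin_apply, map_add, map_sub, map_neg, map_smul, hP.lin_w, hP.lin_v, hY1]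
  module

theorem exists_rot_fixed (hP : P.Adapted A μ ν M) {m n : ℤ} (hB : P.BergAt A μ ν m n) :
    ∃ q : Plane, L.mkQ q ∈ P.spineU ∧ A.toTorus (P.rot (L.mkQ q)) = L.mkQ q := by
  have b0 := P.u_pos 0
  have b1 := P.u_pos 1
  have hν := hP.lt_abs
  have hne : 1 + ν ≠ 0 := by
    intro h
    have : ν = -1 := by linarith
    rw [this] at hν
    norm_num at hν
  obtain ⟨y0, hy0, e0⟩ := hB.adm.unstable 0 ⟨le_rfl, by linarith⟩
  obtain ⟨y1, hy1, e1⟩ := hB.adm.unstable (P.u 0 + P.u 1) ⟨by linarith, le_rfl⟩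
  rw [Set.mem_Icc] at hy0 hy1
  set h := P.u 0 + P.u 1 with hh
  set y := (ν * h - P.latY m n) / (1 + ν) with hy
  have hy' : ν * (h - y) - P.latY m n = y := by
    rw [hy]; field_simp; ring
  have hmem : y ∈ Set.Icc 0 h := by
    rcases lt_abs.1 hν with hν | hν
    · constructor
      · apply div_nonneg <;> nlinarith
      · rw [hy, div_le_iff₀ (by linarith)]; nlinarith
    · constructor
      · apply div_nonneg_of_nonpos <;> nlinarith
      · rw [hy, div_le_iff_of_neg (by linarith)]; nlinarith
  refine ⟨P.o + y • P.w, ⟨0, rfl, y, hmem, ?_⟩, ?_⟩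
  · simp [point]
  · have e2 : L.mkQ (P.o + y • P.w) = P.point 0 y := by simp [point]
    have e3 : P.rot (P.point 0 y) = P.point 0 (h - y) := by
      unfold rot point
      rw [← map_sub, ← hh]
      congr 1
      module
    rw [e2, e3, hB.toTorus_point hP, point_eq_iff]
    exact ⟨m, n, by ring, by linarith⟩

/-! ### Equivalence of Berg partitions -/

theorem Adapted.eq_smul_v (hP : P.Adapted A μ ν M) {z : Plane} {μ' : ℝ} (h : |μ'| < 1)
    (hz : A.lin z = μ' • z) : ∃ α : ℝ, z = α • P.v := by
  obtain ⟨α, β, rfl⟩ := P.exists_coord z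
  simp only [map_add, map_smul, hP.lin_v, hP.lin_w, smul_add, smul_smul] at hz
  have hβ := (P.coord_ext hz).2
  have : β * (ν - μ') = 0 := by linarith
  rcases mul_eq_zero.1 this with h0 | h0
  · exact ⟨α, by rw [h0, zero_smul, add_zero]⟩
  · have := hP.lt_abs
    rw [sub_eq_zero.1 h0] at this
    linarith

theorem Adapted.eq_smul_w (hP : P.Adapted A μ ν M) {z : Plane} {ν' : ℝ} (h : 1 < |ν'|)
    (hz : A.lin z = ν' • z) : ∃ α : ℝ, z = α • P.w := by
  obtain ⟨α, β, rfl⟩ := P.exists_coord z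
  simp only [map_add, map_smul, hP.lin_v, hP.lin_w, smul_add, smul_smul] at hz
  have hβ := (P.coord_ext hz).1
  have : α * (μ - ν') = 0 := by linarith
  rcases mul_eq_zero.1 this with h0 | h0
  · exact ⟨β, by rw [h0, zero_smul, zero_add]⟩
  · have := hP.abs_lt
    rw [sub_eq_zero.1 h0] at this
    linarith

theorem Adapted.eigen_eq {M' : Matrix (Fin 2) (Fin 2) ℤ} {μ' ν' : ℝ} (hP : P.Adapted A μ ν M)
    (hQ : Q.Adapted A μ' ν' M') : μ = μ' ∧ ν = ν' := by
  obtain ⟨α, hα⟩ := hP.eq_smul_v hQ.abs_lt hQ.lin_v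
  obtain ⟨β, hβ⟩ := hP.eq_smul_w hQ.lt_abs hQ.lin_w
  have hv : Q.v ≠ 0 := Q.indep.ne_zero 0
  have hw : Q.w ≠ 0 := Q.indep.ne_zero 1
  have h1 := hQ.lin_v
  have h2 := hQ.lin_w
  have h3 : A.lin Q.v = μ • Q.v := by rw [hα, map_smul, hP.lin_v, smul_comm]
  have h4 : A.lin Q.w = ν • Q.w := by rw [hβ, map_smul, hP.lin_w, smul_comm]
  exact ⟨smul_left_injective ℝ hv (h3.symm.trans h1), smul_left_injective ℝ hw (h4.symm.trans h2)⟩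

/-- The two ratios of the side lengths are determined by the matrix and the eigenvalues. -/
theorem Adapted.exists_ratio (hP : P.Adapted A μ ν M) (hQ : Q.Adapted A μ ν M) :
    ∃ α β : ℝ, 0 < α ∧ 0 < β ∧ (∀ i, α * P.s i = Q.s i) ∧ (∀ i, β * P.u i = Q.u i) := by
  have hP1 := hP.X_map 1 0
  have hQ1 := hQ.X_map 1 0
  have hP2 := hP.Y_map 1 0
  have hQ2 := hQ.Y_map 1 0
  simp only [latX, latY, mul_one, mul_zero, add_zero] at hP1 hQ1 hP2 hQ2
  push_cast at hP1 hQ1 hP2 hQ2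
  have hc : (M 1 0 : ℝ) ≠ 0 := by
    intro hc
    rw [hc] at hP1 hP2
    have h1 := P.s_pos 1
    have h2 := P.u_pos 0
    have e1 : (M 0 0 : ℝ) = μ := mul_right_cancel₀ h1.ne' (by linarith)
    have e2 : (M 0 0 : ℝ) = ν := mul_right_cancel₀ h2.ne' (by linarith)
    have := hP.abs_lt
    have := hP.lt_abs
    rw [← e2, e1] at this
    linarith
  have hα : Q.s 1 / P.s 1 * P.s 1 = Q.s 1 := div_mul_cancel₀ _ (P.s_pos 1).ne'
  have hβ : Q.u 0 / P.u 0 * P.u 0 = Q.u 0 := div_mul_cancel₀ _ (P.u_pos 0).ne'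
  refine ⟨Q.s 1 / P.s 1, Q.u 0 / P.u 0, div_pos (Q.s_pos 1) (P.s_pos 1),
    div_pos (Q.u_pos 0) (P.u_pos 0), ?_, ?_⟩
  · rw [Fin.forall_fin_two]
    refine ⟨mul_left_cancel₀ hc ?_, hα⟩
    linear_combination (-(Q.s 1 / P.s 1)) * hP1 + hQ1 + (M 0 0 - μ) * hα
  · rw [Fin.forall_fin_two]
    refine ⟨hβ, mul_left_cancel₀ hc ?_⟩
    linear_combination (Q.u 0 / P.u 0) * hP2 - hQ2 - (M 0 0 - ν) * hβ

/-- Two bi-partitions with the same matrix are related by a linear automorphism of the lattice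
that maps one basis `(e, f)` to the other one and commutes with `A`. -/
theorem Adapted.exists_conj (hP : P.Adapted A μ ν M) (hQ : Q.Adapted A μ ν M) :
    ∃ (C : ToralAut L) (α β : ℝ), 0 < α ∧ 0 < β ∧ (∀ i, α * P.s i = Q.s i) ∧
      (∀ i, β * P.u i = Q.u i) ∧ C.lin P.v = α • Q.v ∧ C.lin P.w = β • Q.w := by
  obtain ⟨α, β, hα, hβ, hs, hu⟩ := hP.exists_ratio hQ
  let bP := basisOfLinearIndependentOfCardEqFinrank P.indep (by simp)
  let bQ := basisOfLinearIndependentOfCardEqFinrank Q.indep (by simp)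
  let f : Plane ≃ₗ[ℝ] Plane :=
    bP.equiv (bQ.unitsSMul ![Units.mk0 α hα.ne', Units.mk0 β hβ.ne']) (Equiv.refl _)
  have hv : f P.v = α • Q.v := by
    have h0 : bP 0 = P.v := by simp [bP]
    rw [← h0]
    simp [f, bQ, Module.Basis.unitsSMul_apply, Units.smul_def]
  have hw : f P.w = β • Q.w := by
    have h0 : bP 1 = P.w := by simp [bP]
    rw [← h0]
    simp [f, bQ, Module.Basis.unitsSMul_apply, Units.smul_def]
  have hf : ∀ z, f z ∈ L ↔ z ∈ L := by
    intro z
    obtain ⟨x, y, rfl⟩ := P.exists_coord z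
    rw [map_add, map_smul, map_smul, hv, hw, smul_smul, smul_smul, P.mem_lattice, Q.mem_lattice]
    have hX : ∀ m n, Q.latX m n = P.latX m n * α := fun m n => by
      simp only [latX, ← hs]; ring
    have hY : ∀ m n, Q.latY m n = P.latY m n * β := fun m n => by
      simp only [latY, ← hu]; ring
    simp only [hX, hY, mul_left_inj' hα.ne', mul_left_inj' hβ.ne']
  exact ⟨ToralAut.ofMemIff f hf, α, β, hα, hβ, hs, hu, hv, hw⟩

theorem affine_image_Icc {a b c d ξ r : ℝ} (hr : 0 < r) (h1 : ξ + r * a = c) (h2 : ξ + r * b = d) :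
    (fun x => ξ + r * x) '' Set.Icc a b = Set.Icc c d ∧
      (fun x => ξ + r * x) '' Set.Ioo a b = Set.Ioo c d := by
  have h : (fun x => ξ + r * x) = (fun x => ξ + x) ∘ (fun x => r * x) := rfl
  rw [h, Set.image_comp, Set.image_comp, Set.image_mul_left_Icc' hr, Set.image_mul_left_Ioo hr,
    Set.image_const_add_Icc, Set.image_const_add_Ioo, h1, h2]
  exact ⟨rfl, rfl⟩

theorem affine_image_Icc_neg {a b c d ξ r : ℝ} (hr : 0 < r) (h1 : ξ - r * a = d)
    (h2 : ξ - r * b = c) :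
    (fun x => ξ - r * x) '' Set.Icc a b = Set.Icc c d ∧
      (fun x => ξ - r * x) '' Set.Ioo a b = Set.Ioo c d := by
  have h : (fun x => ξ - r * x) = (fun x => ξ - x) ∘ (fun x => r * x) := rfl
  rw [h, Set.image_comp, Set.image_comp, Set.image_mul_left_Icc' hr, Set.image_mul_left_Ioo hr,
    Set.image_const_sub_Icc, Set.image_const_sub_Ioo, h1, h2]
  exact ⟨rfl, rfl⟩

theorem image_image2_point {U : Plane ⧸ L → Plane ⧸ L} {f g : ℝ → ℝ} {S T S' T' : Set ℝ}
    (hU : ∀ x y, U (P.point x y) = Q.point (f x) (g y)) (hf : f '' S = S') (hg : g '' T = T') :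
    U '' Set.image2 P.point S T = Set.image2 Q.point S' T' := by
  rw [Set.image_image2, ← hf, ← hg, Set.image2_image_left, Set.image2_image_right]
  simp only [hU]

theorem bergEquiv_of_eq (hP : P.Adapted A μ ν M) (hQ : Q.Adapted A μ ν M) {m n : ℤ}
    (hPB : P.BergAt A μ ν m n) (hQB : Q.BergAt A μ ν m n) : BergEquiv A P Q := by
  obtain ⟨C, α, β, hα, hβ, hs, hu, hv, hw⟩ := hP.exists_conj hQ
  let U : Plane ⧸ L → Plane ⧸ L := fun z => C.toTorus z + (Q.point 0 0 - C.toTorus (P.point 0 0))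
  have hU : ∀ x y, U (P.point x y) = Q.point (0 + α * x) (0 + β * y) := by
    intro x y
    simp only [U, point, ToralAut.toTorus_mk, ← map_sub, ← map_add]
    congr 1
    simp only [map_add, map_smul, hv, hw]
    module
  refine ⟨U, ⟨C, _, fun _ => rfl⟩, fun z => ?_, ?_⟩
  · obtain ⟨x, y, rfl⟩ := P.exists_point z
    rw [hU, hPB.toTorus_point hP, hQB.toTorus_point hQ, hU]
    congr 1
    · simp only [latX, ← hs]; ring
    · ring
  · have h0 := hs 0
    have h1 := hs 1
    have k0 := hu 0
    have k1 := hu 1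
    rw [Fin.forall_fin_two]
    have r0 := affine_image_Icc (a := 0) (b := P.s 0) (ξ := 0) hα rfl rfl
    have r1 := affine_image_Icc (a := -(P.s 1)) (b := 0) (ξ := 0) hα rfl rfl
    have t0 := affine_image_Icc (a := 0) (b := P.u 0) (ξ := 0) hβ rfl rfl
    have t1 := affine_image_Icc (a := 0) (b := P.u 1) (ξ := 0) hβ rfl rfl
    simp only [mul_zero, add_zero, zero_add, mul_neg, h0, h1, k0, k1] at r0 r1 t0 t1 hU
    exact ⟨⟨image_image2_point hU r0.1 t0.1, image_image2_point hU r0.2 t0.2⟩,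
      ⟨image_image2_point hU r1.1 t1.1, image_image2_point hU r1.2 t1.2⟩⟩

/-- If the displacements of `P` and `Q` are mirror images of each other, then `P` and `Q` are
equivalent by a map whose linear part reverses the directions of the sides: the tiles are
invariant, up to lattice translations, under the rotation about the center of the vertical
spine. -/
theorem bergEquiv_of_reflect (hP : P.Adapted A μ ν M) (hQ : Q.Adapted A μ ν M) {m n m' n' : ℤ}
    (hPB : P.BergAt A μ ν m n) (hQB : Q.BergAt A μ ν m' n')
    (hm : m + m' = M 0 0 + M 0 1 - 1) (hn : n + n' = M 1 0 + M 1 1 - 1) : BergEquiv A P Q := by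
  obtain ⟨C, α, β, hα, hβ, hs, hu, hv, hw⟩ := hP.exists_conj hQ
  let U : Plane ⧸ L → Plane ⧸ L := fun z =>
    (-C).toTorus z + (Q.point 0 (Q.u 0 + Q.u 1) - (-C).toTorus (P.point 0 0))
  have hU : ∀ x y, U (P.point x y) = Q.point (0 - α * x) (Q.u 0 + Q.u 1 - β * y) := by
    intro x y
    simp only [U, point, ToralAut.toTorus_mk, ← map_sub, ← map_add]
    congr 1
    simp only [ToralAut.neg_lin_apply, map_add, map_smul, hv, hw]
    module
  have hU0 : ∀ x y, U (P.point x y) = Q.point (Q.s 0 - α * x) (Q.u 0 - β * y) := by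
    intro x y
    rw [hU, point_eq_iff]
    exact ⟨0, 1, by simp only [latX]; push_cast; ring, by simp only [latY]; push_cast; ring⟩
  have hU1 : ∀ x y, U (P.point x y) = Q.point (-(Q.s 1) - α * x) (Q.u 1 - β * y) := by
    intro x y
    rw [hU, point_eq_iff]
    exact ⟨1, 0, by simp only [latX]; push_cast; ring, by simp only [latY]; push_cast; ring⟩
  refine ⟨U, ⟨-C, _, fun _ => rfl⟩, fun z => ?_, ?_⟩
  · obtain ⟨x, y, rfl⟩ := P.exists_point z
    rw [hU, hPB.toTorus_point hP, hQB.toTorus_point hQ, hU, point_eq_iff]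
    have hX := hQ.X_map 1 1
    have hY := hQ.Y_map 1 1
    refine ⟨M 0 0 + M 0 1 - 1, M 1 0 + M 1 1 - 1, ?_, ?_⟩
    · rw [← hm, ← hn, latX_add]
      simp only [latX, ← hs]
      ring
    · simp only [latY, mul_one] at hY ⊢
      push_cast at hY ⊢
      linear_combination -hY
  · have h0 := hs 0
    have h1 := hs 1
    have k0 := hu 0
    have k1 := hu 1
    rw [Fin.forall_fin_two]
    have r0 := affine_image_Icc_neg (a := 0) (b := P.s 0) (ξ := Q.s 0) hα rfl rfl
    have r1 := affine_image_Icc_neg (a := -(P.s 1)) (b := 0) (ξ := -(Q.s 1)) hα rfl rfl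
    have t0 := affine_image_Icc_neg (a := 0) (b := P.u 0) (ξ := Q.u 0) hβ rfl rfl
    have t1 := affine_image_Icc_neg (a := 0) (b := P.u 1) (ξ := Q.u 1) hβ rfl rfl
    simp only [mul_zero, sub_zero, mul_neg, h0, h1, k0, k1, sub_self] at r0 r1 t0 t1
    exact ⟨⟨image_image2_point hU0 r0.1 t0.1, image_image2_point hU0 r0.2 t0.2⟩,
      ⟨image_image2_point hU1 r1.1 t1.1, image_image2_point hU1 r1.2 t1.2⟩⟩

end Bipartition

/-! ### Connected pieces of open sets -/

/-- A preconnected set covered by disjoint open sets and meeting one of them lies in it. -/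
theorem IsPreconnected.subset_of_cover {Z G : Type*} [TopologicalSpace Z] {S : Set Z}
    (hS : IsPreconnected S) {V : G → Set Z} (hV : ∀ g, IsOpen (V g))
    (hd : ∀ g g' z, z ∈ V g → z ∈ V g' → g = g') (hc : ∀ z ∈ S, ∃ g, z ∈ V g)
    {z : Z} {g : G} (hz : z ∈ S) (hg : z ∈ V g) : S ⊆ V g := by
  refine hS.subset_left_of_subset_union (v := ⋃ g' ∈ {g' | g' ≠ g}, V g') (hV g)
    (isOpen_biUnion fun g' _ => hV g') ?_ ?_ ⟨z, hz, hg⟩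
  · rw [Set.disjoint_left]
    intro y hy hy'
    obtain ⟨g', hne, hg'⟩ := Set.mem_iUnion₂.1 hy'
    exact hne (hd _ _ y hg' hy)
  · intro y hy
    obtain ⟨g', hg'⟩ := hc y hy
    by_cases h : g' = g
    · exact Or.inl (h ▸ hg')
    · exact Or.inr (Set.mem_iUnion₂.2 ⟨g', h, hg'⟩)

/-- A set partitioned into nonempty preconnected open pieces has as many connected components as
there are pieces. -/
theorem card_connectedComponents_of_cover {Z G : Type*} [TopologicalSpace Z] {S : Set Z}
    {V : G → Set Z} (hV : ∀ g, IsOpen (V g)) (hp : ∀ g, IsPreconnected (V g))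
    (hne : ∀ g, (V g).Nonempty) (hd : ∀ g g' z, z ∈ V g → z ∈ V g' → g = g')
    (hS : ∀ z, z ∈ S ↔ ∃ g, z ∈ V g) :
    Nat.card (ConnectedComponents S) = Nat.card G := by
  let W : G → Set S := fun g => Subtype.val ⁻¹' V g
  have hW : ∀ g, IsOpen (W g) := fun g => (hV g).preimage continuous_subtype_val
  have hsub : ∀ g, V g ⊆ S := fun g z hz => (hS z).2 ⟨g, hz⟩
  have hWp : ∀ g, IsPreconnected (W g) := fun g => by
    rw [Topology.IsInducing.subtypeVal.isPreconnected_image.symm, Subtype.image_preimage_coe,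
      Set.inter_eq_right.2 (hsub g)]
    exact hp g
  choose a ha using hne
  let F : G → ConnectedComponents S := fun g => ConnectedComponents.mk ⟨a g, hsub g (ha g)⟩
  refine (Nat.card_congr (Equiv.ofBijective F ⟨?_, ?_⟩)).symm
  · intro g g' h
    have h1 : (⟨a g', hsub g' (ha g')⟩ : S) ∈ connectedComponent (⟨a g, hsub g (ha g)⟩ : S) :=
      ConnectedComponents.coe_eq_coe'.1 h.symm
    have h2 := isPreconnected_connectedComponent.subset_of_cover
      (S := connectedComponent (⟨a g, hsub g (ha g)⟩ : S)) hW
      (fun g g' z => hd g g' z) (fun z _ => (hS z).1 z.2) mem_connectedComponent (ha g)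
    exact hd _ _ _ (h2 h1) (ha g')
  · intro c
    obtain ⟨z, rfl⟩ := ConnectedComponents.surjective_coe c
    obtain ⟨g, hg⟩ := (hS z).1 z.2
    refine ⟨g, ?_⟩
    rw [ConnectedComponents.coe_eq_coe']
    exact (hWp g).subset_connectedComponent hg (ha g)

namespace Bipartition

variable {L : Submodule ℤ Plane} {P Q : Bipartition L} {A : ToralAut L} {μ ν : ℝ}
  {M : Matrix (Fin 2) (Fin 2) ℤ}

theorem isOpen_side (i : Fin 2) : IsOpen (P.side i) := by
  fin_cases i
  · exact isOpen_Ioo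
  · exact isOpen_Ioo

theorem ordConnected_side (i : Fin 2) : (P.side i).OrdConnected := by
  fin_cases i
  · exact Set.ordConnected_Ioo
  · exact Set.ordConnected_Ioo

theorem side_nonempty (i : Fin 2) : (P.side i).Nonempty := by
  fin_cases i
  · exact Set.nonempty_Ioo.2 (P.s_pos 0)
  · exact Set.nonempty_Ioo.2 (neg_lt_zero.2 (P.s_pos 1))

theorem continuous_point : Continuous fun p : ℝ × ℝ => P.point p.1 p.2 := by
  unfold point
  exact continuous_quot_mk.comp (by fun_prop)

/-- The plane `ℝ × ℝ` of coordinates covers the torus by an open map. -/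
theorem isOpenMap_point : IsOpenMap fun p : ℝ × ℝ => P.point p.1 p.2 := by
  let b := basisOfLinearIndependentOfCardEqFinrank P.indep (by simp)
  let e : (ℝ × ℝ) ≃ₗ[ℝ] Plane := (LinearEquiv.finTwoArrow ℝ ℝ).symm.trans b.equivFun.symm
  have he : (fun p : ℝ × ℝ => P.point p.1 p.2) =
      L.mkQ ∘ (Homeomorph.addLeft P.o) ∘ e.toContinuousLinearEquiv := by
    funext p
    have : e p = p.1 • P.v + p.2 • P.w := by
      simp [e, b, Module.Basis.equivFun_symm_apply, Fin.sum_univ_two]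
    simp [point, this, add_assoc]
  rw [he]
  exact (Submodule.isOpenMap_mkQ L).comp ((Homeomorph.addLeft P.o).isOpenMap.comp
    e.toContinuousLinearEquiv.toHomeomorph.isOpenMap)

/-- A connected family of points that stays in the `i`-th open parallelogram of the torus lifts
to a translate of that parallelogram by a single lattice vector. -/
theorem exists_lift {i : Fin 2} {S T : Set ℝ} (hS : IsPreconnected S) (hT : IsPreconnected T)
    (hS0 : S.Nonempty) (hT0 : T.Nonempty) {f g : ℝ → ℝ} (hf : Continuous f) (hg : Continuous g)
    (h : ∀ x ∈ S, ∀ y ∈ T, P.point (f x) (g y) ∈ P.inner i) :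
    ∃ m n, (∀ x ∈ S, f x - P.latX m n ∈ P.side i) ∧
      ∀ y ∈ T, g y - P.latY m n ∈ Set.Ioo 0 (P.u i) := by
  let V : ℤ × ℤ → Set (ℝ × ℝ) := fun p =>
    {z | f z.1 - P.latX p.1 p.2 ∈ P.side i ∧ g z.2 - P.latY p.1 p.2 ∈ Set.Ioo 0 (P.u i)}
  have hV : ∀ p, IsOpen (V p) := fun p =>
    ((isOpen_side i).preimage (by fun_prop)).inter (isOpen_Ioo.preimage (by fun_prop))
  have hd : ∀ p p' z, z ∈ V p → z ∈ V p' → p = p' := by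
    intro p p' z hz hz'
    have := P.side_injective (m := p'.1 - p.1) (n := p'.2 - p.2) hz.1 hz'.1 hz.2 hz'.2
      (by rw [latX_sub]; ring) (by rw [latY_sub]; ring)
    exact Prod.ext (by omega) (by omega)
  have hc : ∀ z ∈ S ×ˢ T, ∃ p, z ∈ V p := by
    rintro ⟨x, y⟩ ⟨hx, hy⟩
    have := h x hx y hy
    rw [inner_eq] at this
    obtain ⟨x', hx', y', hy', he⟩ := this
    obtain ⟨m, n, h1, h2⟩ := P.point_eq_iff.1 he.symm
    refine ⟨(m, n), ?_, ?_⟩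
    · simpa only [← h1, sub_sub_cancel] using hx'
    · simpa only [← h2, sub_sub_cancel] using hy'
  obtain ⟨x, hx⟩ := hS0
  obtain ⟨y, hy⟩ := hT0
  obtain ⟨p, hp⟩ := hc (x, y) ⟨hx, hy⟩
  have hsub := (hS.prod hT).subset_of_cover hV hd hc ⟨hx, hy⟩ hp
  exact ⟨p.1, p.2, fun x' hx' => (hsub (Set.mk_mem_prod hx' hy)).1,
    fun y' hy' => (hsub (Set.mk_mem_prod hx hy')).2⟩

/-! ### Invariance of the displacement under equivalence -/

/-- The lattice contains no line. -/
theorem eq_zero_of_forall_smul_mem (P : Bipartition L) {z : Plane} (h : ∀ r : ℝ, r • z ∈ L) :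
    z = 0 := by
  obtain ⟨x, y, rfl⟩ := P.exists_coord z
  have a0 := P.s_pos 0
  have a1 := P.s_pos 1
  have b0 := P.u_pos 0
  have b1 := P.u_pos 1
  have hD : 0 < P.u 0 * P.s 0 + P.u 1 * P.s 1 := by positivity
  have hint : ∀ c : ℝ, (∀ r : ℝ, ∃ m : ℤ, m * (P.u 0 * P.s 0 + P.u 1 * P.s 1) = r * c) →
      c = 0 := by
    intro c hc
    by_contra hne
    obtain ⟨m, hm⟩ := hc ((P.u 0 * P.s 0 + P.u 1 * P.s 1) / (2 * c))
    have : (m : ℝ) * 2 = 1 := by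
      field_simp at hm
      linarith
    have : m * 2 = 1 := by exact_mod_cast this
    omega
  have hr : ∀ r : ℝ, ∃ m n : ℤ, r * x = P.latX m n ∧ r * y = P.latY m n := fun r => by
    have := h r
    rwa [smul_add, smul_smul, smul_smul, P.mem_lattice] at this
  have h1 : P.u 1 * x + P.s 0 * y = 0 := hint _ fun r => by
    obtain ⟨m, n, hx, hy⟩ := hr r
    unfold latX at hx
    unfold latY at hy
    exact ⟨m, by linear_combination -(P.u 1) * hx - P.s 0 * hy⟩
  have h2 : P.s 1 * y - P.u 0 * x = 0 := hint _ fun r => by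
    obtain ⟨m, n, hx, hy⟩ := hr r
    unfold latX at hx
    unfold latY at hy
    exact ⟨n, by linear_combination P.u 0 * hx - P.s 1 * hy⟩
  have hx : x = 0 := by
    apply mul_right_cancel₀ hD.ne'
    linear_combination P.s 1 * h1 - P.s 0 * h2
  have hy : y = 0 := by
    apply mul_right_cancel₀ hD.ne'
    linear_combination P.u 0 * h1 + P.u 1 * h2
  rw [hx, hy]
  simp

/-- If two affine maps with inverse slopes map two open intervals into each other, then the first
one matches their end points. -/
theorem affine_endpoints {a b c d ξ ζ α : ℝ} (hab : a < b) (hcd : c < d) (hα : α ≠ 0)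
    (h1 : ∀ x ∈ Set.Ioo a b, ξ + α * x ∈ Set.Ioo c d)
    (h2 : ∀ x ∈ Set.Ioo c d, (x - ζ) / α ∈ Set.Ioo a b) :
    (0 < α ∧ ξ + α * a = c ∧ ξ + α * b = d) ∨ (α < 0 ∧ ξ + α * a = d ∧ ξ + α * b = c) := by
  have h1' : Set.MapsTo (fun x => ξ + α * x) (Set.Icc a b) (Set.Icc c d) := by
    rw [← closure_Ioo hab.ne, ← closure_Ioo hcd.ne]
    exact Set.MapsTo.closure h1 (by fun_prop)
  have h2' : Set.MapsTo (fun x => (x - ζ) / α) (Set.Icc c d) (Set.Icc a b) := by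
    rw [← closure_Ioo hab.ne, ← closure_Ioo hcd.ne]
    exact Set.MapsTo.closure h2 (by fun_prop)
  have ha := h1' (Set.left_mem_Icc.2 hab.le)
  have hb := h1' (Set.right_mem_Icc.2 hab.le)
  have hc := h2' (Set.left_mem_Icc.2 hcd.le)
  have hd := h2' (Set.right_mem_Icc.2 hcd.le)
  simp only [Set.mem_Icc] at ha hb hc hd
  rcases lt_or_gt_of_ne hα with h | h
  · rw [div_le_iff_of_neg h, le_div_iff_of_neg h] at hc hd
    exact Or.inr ⟨h, by linarith, by linarith⟩
  · rw [div_le_iff₀ h, le_div_iff₀ h] at hc hd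
    exact Or.inl ⟨h, by linarith, by linarith⟩

/-- The displacements of equivalent Berg partitions agree or are mirror images of each other. An
equivalence maps each open tile onto an open tile, hence acts on the sides by `±1` up to scale;
opposite signs in the two directions would produce a lattice point on an axis. -/
theorem eq_or_reflect_of_bergEquiv (hP : P.Adapted A μ ν M) (hQ : Q.Adapted A μ ν M)
    {m n m' n' : ℤ} (hPB : P.BergAt A μ ν m n) (hQB : Q.BergAt A μ ν m' n')
    (h : BergEquiv A P Q) :
    (m = m' ∧ n = n') ∨ (m + m' = M 0 0 + M 0 1 - 1 ∧ n + n' = M 1 0 + M 1 1 - 1) := by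
  obtain ⟨U, ⟨C, c, hU⟩, hcomm, hi⟩ := h
  have hUinj : Function.Injective U := fun x y hxy => by
    rw [hU, hU] at hxy
    exact C.toTorus.injective (add_right_cancel hxy)
  have hAc : A.toTorus c = c := by
    have := hcomm 0
    simpa [hU] using this
  have hAC : ∀ z, A.lin (C.lin z) = C.lin (A.lin z) := by
    intro z
    rw [← sub_eq_zero]
    apply P.eq_zero_of_forall_smul_mem
    intro r
    have := hcomm (L.mkQ (r • z))
    rw [hU, hU, map_add, hAc, add_left_inj, ToralAut.toTorus_mk, ToralAut.toTorus_mk,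
      ToralAut.toTorus_mk, ToralAut.toTorus_mk] at this
    have := (Submodule.Quotient.eq L).1 this
    simpa only [map_smul, ← smul_sub] using this
  obtain ⟨α, hα⟩ := hQ.eq_smul_v (z := C.lin P.v) hP.abs_lt (by rw [hAC, hP.lin_v, map_smul])
  obtain ⟨β, hβ⟩ := hQ.eq_smul_w (z := C.lin P.w) hP.lt_abs (by rw [hAC, hP.lin_w, map_smul])
  have hα0 : α ≠ 0 := by
    rintro rfl
    rw [zero_smul, LinearEquiv.map_eq_zero_iff] at hα
    exact P.indep.ne_zero 0 hα
  have hβ0 : β ≠ 0 := by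
    rintro rfl
    rw [zero_smul, LinearEquiv.map_eq_zero_iff] at hβ
    exact P.indep.ne_zero 1 hβ
  obtain ⟨ξ, η, h00⟩ := Q.exists_point (U (P.point 0 0))
  have hUp : ∀ x y, U (P.point x y) = Q.point (ξ + α * x) (η + β * y) := by
    intro x y
    have e1 : U (P.point x y) = U (P.point 0 0) + L.mkQ ((α * x) • Q.v + (β * y) • Q.w) := by
      have : (α * x) • Q.v + (β * y) • Q.w = C.lin (x • P.v + y • P.w) := by
        rw [map_add, map_smul, map_smul, hα, hβ, smul_smul, smul_smul, mul_comm x, mul_comm y]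
      rw [this, ← ToralAut.toTorus_mk, hU, hU, add_right_comm _ c, ← map_add]
      congr 2
      rw [point, point, ← map_add]
      congr 1
      module
    rw [e1, h00, point, point, ← map_add]
    congr 1
    module
  have hfwd : ∀ i, ∃ k l, (∀ x ∈ P.side i, ξ + α * x - Q.latX k l ∈ Q.side i) ∧
      ∀ y ∈ Set.Ioo 0 (P.u i), η + β * y - Q.latY k l ∈ Set.Ioo 0 (Q.u i) := by
    intro i
    refine exists_lift (ordConnected_side i).isPreconnected isPreconnected_Ioo (side_nonempty i)
      (Set.nonempty_Ioo.2 (P.u_pos i)) (f := fun x => ξ + α * x) (g := fun y => η + β * y)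
      (by fun_prop) (by fun_prop) fun x hx y hy => ?_
    rw [← hUp, ← (hi i).2, inner_eq]
    exact Set.mem_image_of_mem _ (Set.mem_image2_of_mem hx hy)
  have hbwd : ∀ i, ∃ k l, (∀ x ∈ Q.side i, (x - ξ) / α - P.latX k l ∈ P.side i) ∧
      ∀ y ∈ Set.Ioo 0 (Q.u i), (y - η) / β - P.latY k l ∈ Set.Ioo 0 (P.u i) := by
    intro i
    refine exists_lift (ordConnected_side i).isPreconnected isPreconnected_Ioo (side_nonempty i)
      (Set.nonempty_Ioo.2 (Q.u_pos i)) (f := fun x => (x - ξ) / α) (g := fun y => (y - η) / β)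
      (by fun_prop) (by fun_prop) fun x hx y hy => ?_
    have h1 : Q.point x y ∈ Q.inner i := by
      rw [inner_eq]
      exact Set.mem_image2_of_mem hx hy
    rw [← (hi i).2] at h1
    obtain ⟨z, hz, hzU⟩ := h1
    have h2 : U (P.point ((x - ξ) / α) ((y - η) / β)) = Q.point x y := by
      rw [hUp, mul_div_cancel₀ _ hα0, mul_div_cancel₀ _ hβ0, add_sub_cancel, add_sub_cancel]
    rw [← h2] at hzU
    exact hUinj hzU ▸ hz
  obtain ⟨k0, l0, f0, g0⟩ := hfwd 0
  obtain ⟨k1, l1, f1, g1⟩ := hfwd 1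
  obtain ⟨k0', l0', f0', g0'⟩ := hbwd 0
  obtain ⟨k1', l1', f1', g1'⟩ := hbwd 1
  have hdiv : ∀ {x ξ α c : ℝ}, α ≠ 0 → (x - ξ) / α - c = (x - (ξ + α * c)) / α := by
    intro x ξ α c h
    field_simp
    ring
  simp only [hdiv hα0] at f0' f1'
  simp only [hdiv hβ0] at g0' g1'
  simp only [add_sub_right_comm] at f0 g0 f1 g1
  have X0 := affine_endpoints (P.s_pos 0) (Q.s_pos 0) hα0 f0 f0'
  have X1 := affine_endpoints (neg_lt_zero.2 (P.s_pos 1)) (neg_lt_zero.2 (Q.s_pos 1)) hα0 f1 f1'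
  have Y0 := affine_endpoints (P.u_pos 0) (Q.u_pos 0) hβ0 g0 g0'
  have Y1 := affine_endpoints (P.u_pos 1) (Q.u_pos 1) hβ0 g1 g1'
  have qa0 := Q.s_pos 0
  have qa1 := Q.s_pos 1
  have hcB : U (A.toTorus (P.point 0 0)) = A.toTorus (U (P.point 0 0)) := (hcomm _).symm
  rw [hPB.disp, hUp, hUp, hQB.toTorus_point hQ] at hcB
  rcases lt_or_gt_of_ne hα0 with hαs | hαs <;> rcases lt_or_gt_of_ne hβ0 with hβs | hβs <;>
    simp only [hαs, hβs, hαs.not_gt, hβs.not_gt, true_and, false_and, false_or, or_false, mul_zero,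
      add_zero] at X0 X1 Y0 Y1 hcB
  · right
    have hX : α * P.latX m n = -Q.latX m n := by
      simp only [latX]
      linear_combination (m : ℝ) * (X1.2 - X1.1) - (n : ℝ) * (X0.2 - X0.1)
    rw [point_eq_iff] at hcB
    obtain ⟨k, l, e1, e2⟩ := hcB
    have hX11 := hQ.X_map 1 1
    have hx := hQ.X_map (k0 + 1) l0
    have hy := hQ.Y_map (k0 + 1) l0
    -- `U` maps the base point to `(ξ, η)`, which is congruent to the end `(0, u₀ + u₁)` of the
    -- vertical spine by the lattice point with coefficients `(k0, l0 - 1)`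
    have E1 : ξ = Q.latX (k0 + 1) l0 - Q.latX 1 1 := by
      rw [← latX_sub]
      have := X0.1
      simp only [latX] at this ⊢
      push_cast
      linarith
    have E2 : η = Q.latY (k0 + 1) l0 := by
      have := Y0.1
      simp only [latY] at this ⊢
      push_cast
      linarith
    obtain ⟨rfl, rfl⟩ := hQ.latY_inj (m := k) (n := l)
      (m' := k0 + 1 - (M 0 0 * (k0 + 1) + M 0 1 * l0))
      (n' := l0 - (M 1 0 * (k0 + 1) + M 1 1 * l0))
      (by rw [latY_sub, hy, ← e2, E2])
    rw [latX_sub, hx, hX, E1] at e1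
    refine hQ.latX_inj ?_
    rw [latX_add, latX_sub]
    simp only [mul_one] at hX11
    rw [hX11]
    linear_combination -e1
  · exfalso
    obtain ⟨e1, e2⟩ := hQ.latY_eq_zero (m := k0 - k1) (n := l0 - l1)
      (by rw [latY_sub]; linarith)
    have e3 : Q.latX (k0 - k1) (l0 - l1) = 0 := by rw [e1, e2]; simp [latX]
    rw [latX_sub] at e3
    linarith
  · exfalso
    obtain ⟨e1, e2⟩ := hQ.latX_eq_zero (m := k0 - k1) (n := l0 - l1)
      (by rw [latX_sub]; linarith)
    have e3 : Q.latY (k0 - k1) (l0 - l1) = 0 := by rw [e1, e2]; simp [latY]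
    rw [latY_sub] at e3
    have := hQ.latY_eq_zero (m := 1) (n := -1) (by simp only [latY]; push_cast; linarith)
    omega
  · left
    have hX : α * P.latX m n = Q.latX m n := by
      simp only [latX]
      linear_combination (m : ℝ) * (X1.2 - X1.1) - (n : ℝ) * (X0.2 - X0.1)
    rw [point_eq_iff] at hcB
    obtain ⟨k, l, e1, e2⟩ := hcB
    have hx := hQ.X_map k0 l0
    have hy := hQ.Y_map k0 l0
    obtain ⟨rfl, rfl⟩ := hQ.latY_inj (m := k) (n := l)
      (m' := k0 - (M 0 0 * k0 + M 0 1 * l0)) (n' := l0 - (M 1 0 * k0 + M 1 1 * l0))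
      (by rw [latY_sub, hy, ← e2]; linear_combination (1 - ν) * Y0.1)
    rw [latX_sub, hx, hX] at e1
    exact hQ.latX_inj (by linear_combination e1 - (1 - μ) * X0.1)

end Bipartition

/-! ### The connectivity matrix -/

theorem ordConnected_affine {S T : Set ℝ} (hS : S.OrdConnected) (hT : T.OrdConnected) (c r : ℝ) :
    {x | x ∈ S ∧ (x + c) / r ∈ T}.OrdConnected := by
  refine hS.inter ?_
  rcases le_total 0 r with h | h
  · exact hT.preimage_mono fun x y hxy => div_le_div_of_nonneg_right (by linarith) h
  · exact hT.preimage_anti fun x y hxy => div_le_div_of_nonpos_of_le h (by linarith)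

namespace Bipartition

variable {L : Submodule ℤ Plane} {P : Bipartition L} {A : ToralAut L} {μ ν : ℝ}
  {M : Matrix (Fin 2) (Fin 2) ℤ}

/-- The number of tiles of each kind that are crossed by a vertical segment at `x`, between the
heights of two lattice points through whose horizontal spines it passes. -/
theorem card_tiles_between (P : Bipartition L) {x : ℝ} {k l k' l' : ℤ}
    (h1 : -(P.s 1) < x - P.latX k l) (h2 : x - P.latX k l < P.s 0)
    (h3 : -(P.s 1) < x - P.latX k' l') (h4 : x - P.latX k' l' < P.s 0)
    (hY : P.latY k l < P.latY k' l')
    (hgen : ∀ m n, P.latY k l ≤ P.latY m n → P.latY m n < P.latY k' l' → x ≠ P.latX m n)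
    (j : Fin 2) :
    0 ≤ ![k' - k, l' - l] j ∧ (Nat.card {p : ℤ × ℤ // x - P.latX p.1 p.2 ∈ P.side j ∧
      P.latY k l - P.u j < P.latY p.1 p.2 ∧ P.latY p.1 p.2 < P.latY k' l'} : ℤ) =
      ![k' - k, l' - l] j := by
  have eX := P.latX_sub k' l' k l
  have eY := P.latY_sub k' l' k l
  fin_cases j
  · obtain ⟨r1, -, r3⟩ := card_crossings (x := x - P.latX k l) (P.s_pos 0) (P.s_pos 1)
      (P.u_pos 0) (P.u_pos 1) (k := k' - k) (l := l' - l) h1 h2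
      (by change _ < _ - P.latX (k' - k) (l' - l); linarith)
      (by change _ - P.latX (k' - k) (l' - l) < _; linarith)
      (by change 0 < P.latY (k' - k) (l' - l); linarith)
      (by
        intro m n g1 g2 g3
        change 0 ≤ P.latY m n at g1
        change P.latY m n < P.latY (k' - k) (l' - l) at g2
        change _ = P.latX m n at g3
        have hx := P.latX_add m n k l
        have hy := P.latY_add m n k l
        exact hgen (m + k) (n + l) (by linarith) (by linarith) (by linarith))
    refine ⟨r1, Eq.trans ?_ r3⟩
    congr 1
    refine Nat.card_congr (Equiv.subtypeEquiv (Equiv.subRight (k, l)) fun p => ?_)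
    have hx := P.latX_sub p.1 p.2 k l
    have hy := P.latY_sub p.1 p.2 k l
    change (0 < x - P.latX p.1 p.2 ∧ x - P.latX p.1 p.2 < P.s 0) ∧
      P.latY k l - P.u 0 < P.latY p.1 p.2 ∧ P.latY p.1 p.2 < P.latY k' l' ↔
      (0 < x - P.latX k l - P.latX (p.1 - k) (p.2 - l) ∧
      x - P.latX k l - P.latX (p.1 - k) (p.2 - l) < P.s 0) ∧
      -(P.u 0) < P.latY (p.1 - k) (p.2 - l) ∧
      P.latY (p.1 - k) (p.2 - l) < P.latY (k' - k) (l' - l)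
    rw [hx, hy, eY]
    refine and_congr (and_congr ?_ ?_) (and_congr ?_ ?_) <;>
      constructor <;> intro h <;> linarith
  · obtain ⟨r1, -, r3⟩ := card_crossings (x := -(x - P.latX k l)) (P.s_pos 1) (P.s_pos 0)
      (P.u_pos 1) (P.u_pos 0) (k := l' - l) (l := k' - k) (by linarith) (by linarith)
      (by simp only [latX] at *; push_cast at *; linarith)
      (by simp only [latX] at *; push_cast at *; linarith)
      (by simp only [latY] at *; push_cast at *; linarith)
      (by
        intro m n g1 g2 g3
        have hx := P.latX_add n m k l
        have hy := P.latY_add n m k l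
        refine hgen (n + k) (m + l) ?_ ?_ ?_ <;>
          simp only [latX, latY] at * <;> push_cast at * <;> linarith)
    refine ⟨r1, Eq.trans ?_ r3⟩
    congr 1
    refine Nat.card_congr (Equiv.subtypeEquiv
      ((Equiv.subRight (k, l)).trans (Equiv.prodComm ℤ ℤ)) fun p => ?_)
    have hx := P.latX_sub p.1 p.2 k l
    have hy := P.latY_sub p.1 p.2 k l
    simp only [latX, latY, side, Fin.mk_one, Equiv.trans_apply, Equiv.subRight_apply,
      Equiv.prodComm_apply, Prod.swap, Prod.fst_sub, Prod.snd_sub, Matrix.cons_val_one,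
      Matrix.cons_val_fin_one, Set.mem_Ioo] at *
    push_cast at *
    rw [and_comm (a := -(P.s 1) < _)]
    refine and_congr (and_congr ?_ ?_) (and_congr ?_ ?_) <;>
      constructor <;> intro h <;> linarith

/-- The image of the `i`-th open tile does not meet the lattice translates of the vertical
spine, because the spine is contained in its own image. -/
theorem BergAt.not_spine (hP : P.Adapted A μ ν M) {m0 n0 : ℤ} (hB : P.BergAt A μ ν m0 n0)
    {i : Fin 2} {m n : ℤ} {y : ℝ} (hx : (P.latX m n - P.latX m0 n0) / μ ∈ P.side i)
    (hy : y / ν ∈ Set.Ioo 0 (P.u i)) (hY : y - P.latY m n ∈ Set.Icc 0 (P.u 0 + P.u 1)) :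
    False := by
  obtain ⟨y', hy', e⟩ := hB.adm.unstable _ hY
  obtain ⟨k, l, e1, e2⟩ := hP.surj (m - m0) (n - n0)
  rw [latX_sub] at e1
  rw [latY_sub] at e2
  rw [e1, mul_div_cancel_left₀ _ hP.μ_ne] at hx
  have e3 : y / ν = y' + P.latY k l := by
    rw [div_eq_iff hP.ν_ne]
    linear_combination e + e2
  rw [e3] at hy
  exact P.not_spine_of_mem_side hx (by linarith [hy.1, hy'.2]) (by linarith [hy.2, hy'.1])

/-- The Markov property: if the image of the `i`-th tile meets a translate of the `j`-th one, then
it crosses it in the horizontal direction from one side to the other. -/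
theorem BergAt.markov (hP : P.Adapted A μ ν M) {m0 n0 : ℤ} (hB : P.BergAt A μ ν m0 n0)
    {i j : Fin 2} {m n : ℤ} {x x' y : ℝ} (hx : (x - P.latX m0 n0) / μ ∈ P.side i)
    (hy : y / ν ∈ Set.Ioo 0 (P.u i)) (hX : x - P.latX m n ∈ P.side j)
    (hY : y - P.latY m n ∈ Set.Ioo 0 (P.u j)) (hx' : (x' - P.latX m0 n0) / μ ∈ P.side i) :
    x' - P.latX m n ∈ P.side j := by
  have b0 := P.u_pos 0
  have b1 := P.u_pos 1
  have hord := ordConnected_affine Set.ordConnected_univ (ordConnected_side (P := P) i)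
    (-P.latX m0 n0) μ
  have hbt : ∀ z, (x ≤ z ∧ z ≤ x') ∨ (x' ≤ z ∧ z ≤ x) → (z - P.latX m0 n0) / μ ∈ P.side i := by
    intro z hz
    rw [sub_eq_add_neg] at *
    rcases hz with hz | hz
    · exact (hord.out ⟨trivial, hx⟩ ⟨trivial, hx'⟩ hz).2
    · exact (hord.out ⟨trivial, hx'⟩ ⟨trivial, hx⟩ hz).2
  have e1 : P.latX m (n - 1) = P.latX m n + P.s 0 := by simp only [latX]; push_cast; ring
  have e2 : P.latY m (n - 1) = P.latY m n - P.u 1 := by simp only [latY]; push_cast; ring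
  have e3 : P.latX (m - 1) n = P.latX m n - P.s 1 := by simp only [latX]; push_cast; ring
  have e4 : P.latY (m - 1) n = P.latY m n - P.u 0 := by simp only [latY]; push_cast; ring
  by_contra hne
  fin_cases j
  · change ¬ (0 < _ ∧ _ < P.s 0) at hne
    change 0 < _ ∧ _ < P.s 0 at hX
    change 0 < _ ∧ _ < P.u 0 at hY
    rw [not_and_or, not_lt, not_lt] at hne
    rcases hne with h | h
    · exact hB.not_spine hP (m := m) (n := n) (hbt _ (Or.inr ⟨by linarith, by linarith⟩)) hy
        ⟨by linarith, by linarith⟩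
    · exact hB.not_spine hP (m := m) (n := n - 1)
        (by rw [e1]; exact hbt _ (Or.inl ⟨by linarith, by linarith⟩)) hy
        (by rw [e2]; exact ⟨by linarith, by linarith⟩)
  · change ¬ (-(P.s 1) < _ ∧ _ < 0) at hne
    change -(P.s 1) < _ ∧ _ < 0 at hX
    change 0 < _ ∧ _ < P.u 1 at hY
    rw [not_and_or, not_lt, not_lt] at hne
    rcases hne with h | h
    · exact hB.not_spine hP (m := m - 1) (n := n)
        (by rw [e3]; exact hbt _ (Or.inr ⟨by linarith, by linarith⟩)) hy
        (by rw [e4]; exact ⟨by linarith, by linarith⟩)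
    · exact hB.not_spine hP (m := m) (n := n) (hbt _ (Or.inl ⟨by linarith, by linarith⟩)) hy
        ⟨by linarith, by linarith⟩

/-- The components of `A (Rᵢ°) ∩ Rⱼ°` are the projections of the intersections of the parallelogram
`A (Rᵢ°)` with the lattice translates of `Rⱼ°` in the plane. -/
theorem BergAt.connectivity_eq_card (hP : P.Adapted A μ ν M) {m0 n0 : ℤ}
    (hB : P.BergAt A μ ν m0 n0) (i j : Fin 2) :
    P.connectivity A i j = Nat.card {p : ℤ × ℤ // ∃ x y,
      (x - P.latX m0 n0) / μ ∈ P.side i ∧ y / ν ∈ Set.Ioo 0 (P.u i) ∧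
      x - P.latX p.1 p.2 ∈ P.side j ∧ y - P.latY p.1 p.2 ∈ Set.Ioo 0 (P.u j)} := by
  let S : ℤ × ℤ → Set ℝ := fun p =>
    {x | x ∈ P.side j ∧ (x + (P.latX p.1 p.2 - P.latX m0 n0)) / μ ∈ P.side i}
  let T : ℤ × ℤ → Set ℝ := fun p =>
    {y | y ∈ Set.Ioo 0 (P.u j) ∧ (y + P.latY p.1 p.2) / ν ∈ Set.Ioo 0 (P.u i)}
  have hSo : ∀ p, IsOpen (S p) := fun p =>
    (isOpen_side j).inter ((isOpen_side i).preimage (by fun_prop))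
  have hTo : ∀ p, IsOpen (T p) := fun p =>
    isOpen_Ioo.inter (isOpen_Ioo.preimage (by fun_prop))
  refine card_connectedComponents_of_cover
    (V := fun p : {p : ℤ × ℤ // ∃ x y,
      (x - P.latX m0 n0) / μ ∈ P.side i ∧ y / ν ∈ Set.Ioo 0 (P.u i) ∧
      x - P.latX p.1 p.2 ∈ P.side j ∧ y - P.latY p.1 p.2 ∈ Set.Ioo 0 (P.u j)} =>
      (fun z : ℝ × ℝ => P.point z.1 z.2) '' (S p.1 ×ˢ T p.1))
    (fun p => isOpenMap_point _ ((hSo _).prod (hTo _))) (fun p => ?_) (fun p => ?_) ?_ ?_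
  · exact ((ordConnected_affine (ordConnected_side j) (ordConnected_side i) _ _).isPreconnected.prod
      (ordConnected_affine Set.ordConnected_Ioo Set.ordConnected_Ioo _ _).isPreconnected).image _
      continuous_point.continuousOn
  · obtain ⟨p, x, y, h1, h2, h3, h4⟩ := p
    refine ⟨_, (x - P.latX p.1 p.2, y - P.latY p.1 p.2), ⟨⟨h3, ?_⟩, h4, ?_⟩, rfl⟩
    · rwa [← add_sub_assoc, sub_add_cancel]
    · rwa [sub_add_cancel]
  · rintro p p' z ⟨⟨x, y⟩, ⟨⟨g1, g2⟩, g3, g4⟩, rfl⟩ ⟨⟨x', y'⟩, ⟨⟨g1', g2'⟩, g3', g4'⟩, he⟩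
    dsimp only at *
    obtain ⟨m, n, e1, e2⟩ := P.point_eq_iff.1 he
    obtain ⟨rfl, rfl⟩ := P.side_injective g1' g1 g3' g3 e1 e2
    have hx : x' = x := by simpa [latX, sub_eq_zero] using e1
    have hy : y' = y := by simpa [latY, sub_eq_zero] using e2
    subst hx hy
    obtain ⟨k, l, r1, r2⟩ := hP.surj (p.1.1 - p'.1.1) (p.1.2 - p'.1.2)
    rw [latX_sub] at r1
    rw [latY_sub] at r2
    have hμ := hP.μ_ne
    have hν := hP.ν_ne
    obtain ⟨rfl, rfl⟩ := P.side_injective (m := k) (n := l) g2 g2' g4 g4'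
      (by field_simp; linear_combination r1) (by field_simp; linear_combination r2)
    have h0 := hP.latX_inj (m := p.1.1) (n := p.1.2) (m' := p'.1.1) (n' := p'.1.2)
      (by rw [← sub_eq_zero, r1]; simp [latX])
    exact Subtype.ext (Prod.ext h0.1 h0.2)
  · intro z
    rw [inner_eq, inner_eq]
    constructor
    · rintro ⟨⟨_, ⟨x', hx', y', hy', rfl⟩, he⟩, ⟨x, hx, y, hy, rfl⟩⟩
      rw [hB.toTorus_point hP, point_eq_iff] at he
      obtain ⟨m, n, e1, e2⟩ := he
      have r1 : (x + (P.latX m n - P.latX m0 n0)) / μ = x' := by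
        rw [← e1, div_eq_iff hP.μ_ne]; ring
      have r2 : (y + P.latY m n) / ν = y' := by
        rw [← e2, div_eq_iff hP.ν_ne]; ring
      refine ⟨⟨(m, n), x + P.latX m n, y + P.latY m n, ?_, ?_, ?_, ?_⟩, (x, y),
        ⟨⟨hx, ?_⟩, hy, ?_⟩, rfl⟩
      · rw [add_sub_assoc, r1]; exact hx'
      · rw [r2]; exact hy'
      · rwa [add_sub_cancel_right]
      · rwa [add_sub_cancel_right]
      · dsimp only; rw [r1]; exact hx'
      · dsimp only; rw [r2]; exact hy'
    · rintro ⟨p, ⟨x, y⟩, ⟨⟨g1, g2⟩, g3, g4⟩, rfl⟩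
      dsimp only at *
      refine ⟨⟨_, ⟨_, g2, _, g4, rfl⟩, ?_⟩, ⟨x, g1, y, g3, rfl⟩⟩
      rw [hB.toTorus_point hP, mul_div_cancel₀ _ hP.μ_ne, mul_div_cancel₀ _ hP.ν_ne, point_eq_iff]
      exact ⟨p.1.1, p.1.2, by ring, by ring⟩

/-- All entries of the matrix of `A` in the basis `(e, f)` of a Berg partition have the sign of the
expanding eigenvalue, and their absolute values form the transposed connectivity matrix. -/
theorem BergAt.connectivity_eq (hP : P.Adapted A μ ν M) {m0 n0 : ℤ}
    (hB : P.BergAt A μ ν m0 n0) (i j : Fin 2) :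
    (0 < ν → 0 ≤ M j i ∧ (P.connectivity A i j : ℤ) = M j i) ∧
      (ν < 0 → M j i ≤ 0 ∧ (P.connectivity A i j : ℤ) = -M j i) := by
  have a0 := P.s_pos 0
  have a1 := P.s_pos 1
  have b0 := P.u_pos 0
  have b1 := P.u_pos 1
  have hμ := hP.μ_ne
  have hui := P.u_pos i
  have huj := P.u_pos j
  -- the image of the `i`-th tile is met along the line above the middle of its base
  obtain ⟨c, hc, hc1, hc2, hX1, hX2⟩ : ∃ c ∈ P.side i, -(P.s 1) < c ∧ c < P.s 0 ∧
      (∃ c', -(P.s 1) < c' ∧ c' < P.s 0 ∧ μ * c - P.latX (M 0 i) (M 1 i) = μ * c') ∧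
      P.latY (M 0 i) (M 1 i) = ν * P.u i := by
    have hx1 := hP.X_map 1 0
    have hx2 := hP.X_map 0 1
    have hy1 := hP.Y_map 1 0
    have hy2 := hP.Y_map 0 1
    simp only [mul_one, mul_zero, add_zero, zero_add] at hx1 hx2 hy1 hy2
    fin_cases i
    · refine ⟨P.s 0 / 2, ⟨by linarith, by linarith⟩, by linarith, by linarith,
        ⟨P.s 0 / 2 - P.s 1, by linarith, by linarith, ?_⟩, ?_⟩
      · simp only [Fin.zero_eta]; rw [hx1]; simp only [latX]; push_cast; ring
      · simp only [Fin.zero_eta]; rw [hy1]; simp only [latY]; push_cast; ring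
    · refine ⟨-(P.s 1) / 2, ⟨by linarith, by linarith⟩, by linarith, by linarith,
        ⟨-(P.s 1) / 2 + P.s 0, by linarith, by linarith, ?_⟩, ?_⟩
      · simp only [Fin.mk_one]; rw [hx2]; simp only [latX]; push_cast; ring
      · simp only [Fin.mk_one]; rw [hy2]; simp only [latY]; push_cast; ring
  obtain ⟨c', hc1', hc2', hcc'⟩ := hX1
  have hstrict : ∀ t, -(P.s 1) < t → t < P.s 0 →
      -(P.s 1) < μ * t + P.latX m0 n0 ∧ μ * t + P.latX m0 n0 < P.s 0 := by
    intro t h1 h2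
    have r1 := hB.adm.stable (-(P.s 1)) ⟨le_rfl, by linarith⟩
    have r2 := hB.adm.stable (P.s 0) ⟨by linarith, le_rfl⟩
    rw [Set.mem_Icc] at r1 r2
    rcases lt_or_gt_of_ne hμ with h | h
    · constructor <;> nlinarith
    · constructor <;> nlinarith
  set x := μ * c + P.latX m0 n0 with hx
  have hxi : (x - P.latX m0 n0) / μ ∈ P.side i := by
    rw [hx, add_sub_cancel_right, mul_div_cancel_left₀ _ hμ]; exact hc
  obtain ⟨s1, s2⟩ := hstrict c hc1 hc2
  obtain ⟨s3, s4⟩ := hstrict c' hc1' hc2'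
  have hX0 : P.latX 0 0 = 0 := by simp [latX]
  have hY0 : P.latY 0 0 = 0 := by simp [latY]
  have hmain : ∀ k l k' l' : ℤ, P.latY k l < P.latY k' l' →
      (∀ y, y / ν ∈ Set.Ioo 0 (P.u i) ↔ y ∈ Set.Ioo (P.latY k l) (P.latY k' l')) →
      -(P.s 1) < x - P.latX k l → x - P.latX k l < P.s 0 →
      -(P.s 1) < x - P.latX k' l' → x - P.latX k' l' < P.s 0 →
      0 ≤ ![k' - k, l' - l] j ∧ (P.connectivity A i j : ℤ) = ![k' - k, l' - l] j := by
    intro k l k' l' hlt hiff g1 g2 g3 g4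
    obtain ⟨r1, r2⟩ := P.card_tiles_between g1 g2 g3 g4 hlt (by
      intro m n q1 q2 q3
      obtain ⟨y, hy1, hy2⟩ := exists_between
        (lt_min q2 (by linarith : P.latY m n < P.latY m n + (P.u 0 + P.u 1)))
      rw [lt_min_iff] at hy2
      exact hB.not_spine hP (m := m) (n := n) (q3 ▸ hxi) ((hiff y).2 ⟨by linarith, hy2.1⟩)
        ⟨by linarith, by linarith⟩) j
    refine ⟨r1, r2 ▸ ?_⟩
    rw [hB.connectivity_eq_card hP]
    congr 1
    refine Nat.card_congr (Equiv.subtypeEquivRight fun p => ?_)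
    constructor
    · rintro ⟨x', y, h1, h2, h3, h4⟩
      refine ⟨hB.markov hP h1 h2 h3 h4 hxi, ?_⟩
      rw [hiff] at h2
      rw [Set.mem_Ioo] at h2 h4
      exact ⟨by linarith, by linarith⟩
    · rintro ⟨h1, h2, h3⟩
      obtain ⟨y, hy1, hy2⟩ := exists_between
        (max_lt (lt_min hlt (by linarith)) (lt_min h3 (by linarith)) :
          max (P.latY k l) (P.latY p.1 p.2) <
            min (P.latY k' l') (P.latY p.1 p.2 + P.u j))
      rw [max_lt_iff] at hy1
      rw [lt_min_iff] at hy2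
      exact ⟨x, y, hxi, (hiff y).2 ⟨hy1.1, hy2.1⟩, h1, by linarith, by linarith⟩
  constructor
  · intro hν
    have := hmain 0 0 (M 0 i) (M 1 i) (by rw [hY0, hX2]; positivity) (by
      intro y
      rw [hY0, hX2, Set.mem_Ioo, Set.mem_Ioo, div_pos_iff_of_pos_right hν, div_lt_iff₀ hν,
        mul_comm ν]) (by linarith) (by linarith) (by linarith) (by linarith)
    fin_cases j <;> simpa using this
  · intro hν
    have := hmain (M 0 i) (M 1 i) 0 0 (by rw [hY0, hX2]; nlinarith) (by
      intro y
      rw [hY0, hX2, Set.mem_Ioo, Set.mem_Ioo, div_lt_iff_of_neg hν, lt_div_iff_of_neg hν,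
        mul_comm ν, zero_mul, and_comm]) (by linarith) (by linarith) (by linarith) (by linarith)
    fin_cases j <;> simpa using this

end Bipartition

/-! ### Counting the admissible lattice points -/

namespace Bipartition

variable {L : Submodule ℤ Plane} {P : Bipartition L} {A : ToralAut L} {μ ν : ℝ}
  {M : Matrix (Fin 2) (Fin 2) ℤ}

theorem Adapted.latX_mem_Ioo (hP : P.Adapted A μ ν M) {m n : ℤ} (h : P.Admissible μ ν m n) :
    P.latX m n ∈ Set.Ioo (-(P.s 1)) (P.s 0) := by
  have a0 := P.s_pos 0
  have a1 := P.s_pos 1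
  have r1 := h.stable (-(P.s 1)) ⟨le_rfl, by linarith⟩
  have r2 := h.stable (P.s 0) ⟨by linarith, le_rfl⟩
  rw [Set.mem_Icc] at r1 r2
  rcases lt_or_gt_of_ne hP.μ_ne with h | h
  · constructor <;> nlinarith
  · constructor <;> nlinarith

/-- The rectangle whose diagonal joins `f` and `e` horizontally and `0` and `e + f` vertically has
no lattice point in its interior. -/
theorem not_mem_inner_rect (P : Bipartition L) {m n : ℤ} (h1 : -(P.s 0) < P.latX m n)
    (h2 : P.latX m n < P.s 1) (h3 : 0 < P.latY m n) (h4 : P.latY m n < P.u 0 + P.u 1) :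
    False := by
  have a0 := P.s_pos 0
  have a1 := P.s_pos 1
  have b0 := P.u_pos 0
  have b1 := P.u_pos 1
  have hs := P.lat_same_sign (m := m) (n := n) (by rw [_root_.abs_lt]; constructor <;> linarith)
  rcases hs with ⟨hm, hn⟩ | ⟨hm, hn⟩
  · rcases (by omega : (m = 0 ∧ n = 0) ∨ (m = 0 ∧ 1 ≤ n) ∨ (1 ≤ m ∧ n = 0) ∨ (1 ≤ m ∧ 1 ≤ n)) with
      ⟨rfl, rfl⟩ | ⟨rfl, h⟩ | ⟨h, rfl⟩ | ⟨h, h'⟩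
    · simp [latY] at h3
    · have : (1 : ℝ) ≤ n := by exact_mod_cast h
      simp only [latX] at h1
      push_cast at h1
      nlinarith
    · have : (1 : ℝ) ≤ m := by exact_mod_cast h
      simp only [latX] at h2
      push_cast at h2
      nlinarith
    · have r1 : (1 : ℝ) ≤ m := by exact_mod_cast h
      have r2 : (1 : ℝ) ≤ n := by exact_mod_cast h'
      simp only [latY] at h4
      nlinarith
  · have := P.latY_nonpos hm hn
    linarith

/-- For a positive expanding eigenvalue, every lattice point in the vertical strip over the
horizontal spine and in the admissible range of heights is admissible. Otherwise adding `e` or `f`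
would bring it so close to the vertical axis that its preimage under `A` would lie in a rectangle
without lattice points. -/
theorem Adapted.admissible_of_mem (hP : P.Adapted A μ ν M) (hν : 0 < ν) {m n : ℤ}
    (hX : P.latX m n ∈ Set.Icc (-(P.s 1)) (P.s 0)) (hY : 0 ≤ P.latY m n)
    (hY' : P.latY m n ≤ (ν - 1) * (P.u 0 + P.u 1)) : P.Admissible μ ν m n := by
  have a0 := P.s_pos 0
  have a1 := P.s_pos 1
  have b0 := P.u_pos 0
  have b1 := P.u_pos 1
  have hμ := hP.μ_ne
  rw [Set.mem_Icc] at hX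
  constructor
  · intro x hx
    rw [Set.mem_Icc] at hx
    by_contra hne
    rw [Set.mem_Icc, not_and_or, not_le, not_le] at hne
    rcases hne with h | h
    · obtain ⟨k, l, e1, e2⟩ := hP.surj (m + 1) n
      have r1 : P.latX (m + 1) n = P.latX m n + P.s 1 := by simp only [latX]; push_cast; ring
      have r2 : P.latY (m + 1) n = P.latY m n + P.u 0 := by simp only [latY]; push_cast; ring
      refine P.not_mem_inner_rect (m := k) (n := l) ?_ ?_ ?_ ?_
      · rcases lt_or_gt_of_ne hμ with hs | hs <;> nlinarith
      · rcases lt_or_gt_of_ne hμ with hs | hs <;> nlinarith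
      · nlinarith
      · nlinarith
    · obtain ⟨k, l, e1, e2⟩ := hP.surj m (n + 1)
      have r1 : P.latX m (n + 1) = P.latX m n - P.s 0 := by simp only [latX]; push_cast; ring
      have r2 : P.latY m (n + 1) = P.latY m n + P.u 1 := by simp only [latY]; push_cast; ring
      refine P.not_mem_inner_rect (m := k) (n := l) ?_ ?_ ?_ ?_
      · rcases lt_or_gt_of_ne hμ with hs | hs <;> nlinarith
      · rcases lt_or_gt_of_ne hμ with hs | hs <;> nlinarith
      · nlinarith
      · nlinarith
  · intro y hy
    rw [Set.mem_Icc] at hy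
    refine ⟨(y + P.latY m n) / ν, ⟨div_nonneg (by linarith) hν.le, ?_⟩,
      (mul_div_cancel₀ _ hν.ne').symm⟩
    rw [div_le_iff₀ hν]
    linarith

theorem Adapted.latY_nonneg_of_admissible (hν : 0 < ν) {m n : ℤ}
    (h : P.Admissible μ ν m n) : 0 ≤ P.latY m n := by
  obtain ⟨y', hy', e⟩ := h.unstable 0 ⟨le_rfl, by linarith [P.u_pos 0, P.u_pos 1]⟩
  rw [zero_add] at e
  rw [e]
  exact mul_nonneg hν.le hy'.1

theorem Adapted.level_nonneg (hP : P.Adapted A μ ν M) (hν : 0 < ν) {m n : ℤ}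
    (h : P.Admissible μ ν m n) : 0 ≤ m + n := by
  have a0 := P.s_pos 0
  have a1 := P.s_pos 1
  have hX := hP.latX_mem_Ioo h
  rw [Set.mem_Ioo] at hX
  have hs := P.lat_same_sign (m := m) (n := n) (by rw [_root_.abs_lt]; constructor <;> linarith)
  have hY := latY_nonneg_of_admissible hν h
  rcases hs with hs' | hs'
  · omega
  · have h0 := P.latY_nonpos hs'.1 hs'.2
    obtain ⟨rfl, rfl⟩ := P.eq_zero_of_same_sign (Or.inr hs') (le_antisymm h0 hY)
    simp

theorem Adapted.level_le (hP : P.Adapted A μ ν M) (hν : 0 < ν) {m n : ℤ}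
    (h : P.Admissible μ ν m n) : m + n ≤ M 0 0 + M 0 1 + M 1 0 + M 1 1 - 2 := by
  have := hP.level_nonneg hν (hP.adm_reflect h)
  omega

/-- Admissibility depends on the matrix and the eigenvalues only. -/
theorem Adapted.admissible_congr {Q : Bipartition L} (hP : P.Adapted A μ ν M)
    (hQ : Q.Adapted A μ ν M) {m n : ℤ} (h : Q.Admissible μ ν m n) : P.Admissible μ ν m n := by
  obtain ⟨α, β, hα, hβ, hs, hu⟩ := hP.exists_ratio hQ
  have hX : Q.latX m n = α * P.latX m n := by simp only [latX, ← hs]; ring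
  have hY : Q.latY m n = β * P.latY m n := by simp only [latY, ← hu]; ring
  constructor
  · intro x hx
    rw [Set.mem_Icc] at hx
    have := h.stable (α * x) (by rw [← hs, ← hs]; constructor <;> nlinarith)
    rw [← hs, ← hs, hX, Set.mem_Icc] at this
    constructor
    · refine le_of_mul_le_mul_left ?_ hα
      linarith
    · refine le_of_mul_le_mul_left ?_ hα
      linarith
  · intro y hy
    rw [Set.mem_Icc] at hy
    obtain ⟨y', hy', e⟩ := h.unstable (β * y) (by rw [← hu, ← hu]; constructor <;> nlinarith)
    rw [← hu, ← hu, Set.mem_Icc] at hy'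
    refine ⟨y' / β, ⟨div_nonneg hy'.1 hβ.le, ?_⟩, ?_⟩
    · rw [div_le_iff₀ hβ]
      linarith
    · rw [hY] at e
      field_simp
      linarith

theorem Adapted.eq_of_level_eq (hP : P.Adapted A μ ν M) {m n m' n' : ℤ}
    (h : P.Admissible μ ν m n) (h' : P.Admissible μ ν m' n') (he : m + n = m' + n') :
    m = m' ∧ n = n' := by
  have a0 := P.s_pos 0
  have a1 := P.s_pos 1
  have hX := hP.latX_mem_Ioo h
  have hX' := hP.latX_mem_Ioo h'
  rw [Set.mem_Ioo] at hX hX'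
  have hs := P.lat_same_sign (m := m - m') (n := n - n')
    (by rw [latX_sub, _root_.abs_lt]; constructor <;> linarith)
  omega

/-- Every level between `0` and `σ - 2`, where `σ` is the sum of the entries of the matrix,
contains an admissible lattice point. -/
theorem Adapted.exists_level (hP : P.Adapted A μ ν M) (hν : 0 < ν) {i : ℤ} (h0 : 0 ≤ i)
    (hi : i ≤ M 0 0 + M 0 1 + M 1 0 + M 1 1 - 2) :
    ∃ m n, m + n = i ∧ P.Admissible μ ν m n := by
  have a0 := P.s_pos 0
  have a1 := P.s_pos 1
  have b0 := P.u_pos 0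
  have b1 := P.u_pos 1
  have hν1 : 1 < ν := by
    have := hP.lt_abs
    rwa [abs_of_pos hν] at this
  obtain ⟨m, hm, -⟩ := existsUnique_add_zsmul_mem_Ico (add_pos a0 a1) (-(i * P.s 0)) (-(P.s 1))
  simp only [zsmul_eq_mul, Set.mem_Ico] at hm
  have hXe : P.latX m (i - m) = -(i * P.s 0) + m * (P.s 0 + P.s 1) := by
    simp only [latX]; push_cast; ring
  have hX : -(P.s 1) ≤ P.latX m (i - m) ∧ P.latX m (i - m) < P.s 0 := by
    rw [hXe]
    exact ⟨hm.1, by linarith [hm.2]⟩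
  have hX00 : P.latX 0 0 = 0 := by simp [latX]
  have hY00 : P.latY 0 0 = 0 := by simp [latY]
  -- the admissible point opposite to the origin bounds the heights from above
  have hadm0 : P.Admissible μ ν 0 0 := hP.admissible_of_mem hν
    (by rw [hX00]; exact ⟨by linarith, a0.le⟩) hY00.ge (by rw [hY00]; nlinarith)
  have htop := hP.latX_mem_Ioo (hP.adm_reflect hadm0)
  rw [sub_zero, sub_zero, Set.mem_Ioo] at htop
  have hYtop : P.latY (M 0 0 + M 0 1 - 1) (M 1 0 + M 1 1 - 1) = (ν - 1) * (P.u 0 + P.u 1) := by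
    have := hP.Y_map 1 1
    rw [latY_sub, ← mul_one (M 0 0), ← mul_one (M 0 1), ← mul_one (M 1 0), ← mul_one (M 1 1), this]
    simp only [latY]
    push_cast
    ring
  have hs1 := P.lat_same_sign (m := m) (n := i - m)
    (by rw [_root_.abs_lt]; constructor <;> linarith)
  have hs2 := P.lat_same_sign (m := M 0 0 + M 0 1 - 1 - m) (n := M 1 0 + M 1 1 - 1 - (i - m))
    (by rw [latX_sub, _root_.abs_lt]; constructor <;> linarith)
  have hY1 := P.latY_nonneg (m := m) (n := i - m) (by omega) (by omega)
  have hY2 := P.latY_nonneg (m := M 0 0 + M 0 1 - 1 - m) (n := M 1 0 + M 1 1 - 1 - (i - m))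
    (by omega) (by omega)
  rw [latY_sub, hYtop] at hY2
  exact ⟨m, i - m, by ring, hP.admissible_of_mem hν ⟨hX.1, hX.2.le⟩ hY1 (by linarith)⟩

/-- Every admissible lattice point is the displacement of the base point of a suitable translate. -/
theorem Adapted.exists_bergAt (hP : P.Adapted A μ ν M) {m n : ℤ} (h : P.Admissible μ ν m n) :
    ∃ Q : Bipartition L, Q.Adapted A μ ν M ∧ Q.BergAt A μ ν m n := by
  have hμ : μ - 1 ≠ 0 := by
    have := hP.abs_lt
    intro h0
    rw [sub_eq_zero.1 h0] at this
    norm_num at this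
  refine ⟨{P with o := (P.latX m n / (μ - 1)) • P.v}, hP.move _, ?_, ⟨h.1, h.2⟩⟩
  simp only [point, ToralAut.toTorus_mk]
  congr 1
  simp only [map_smul, hP.lin_v, latX, zero_smul, add_zero, smul_smul, ← add_smul]
  congr 1
  field_simp
  ring

/-! ### Construction of a bi-partition from a non-negative matrix -/

/-- Eigenvalues of a non-negative hyperbolic matrix of determinant `±1`. -/
theorem exists_eigenvalues {a b c d : ℝ} (hb : 0 < b) (hc : 0 < c) (ht : 0 < a + d)
    (hdet : |a * d - b * c| = 1) :
    ∃ μ ν : ℝ, μ + ν = a + d ∧ μ * ν = a * d - b * c ∧ μ < a ∧ a < ν ∧ |μ| < 1 ∧ 1 < ν := by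
  have hD : 0 < (a - d) ^ 2 + 4 * (b * c) := by positivity
  set r := √((a - d) ^ 2 + 4 * (b * c)) with hr
  have hr2 : r ^ 2 = (a - d) ^ 2 + 4 * (b * c) := Real.sq_sqrt hD.le
  have hr0 : 0 < r := Real.sqrt_pos.2 hD
  have hbc : 0 < b * c := mul_pos hb hc
  have hlt : |a - d| < r := abs_lt_of_sq_lt_sq (by linarith) hr0.le
  rw [abs_lt] at hlt
  have hprod : (a + d - r) / 2 * ((a + d + r) / 2) = a * d - b * c := by
    linear_combination (-1 / 4) * hr2
  have habs : |(a + d - r) / 2| < (a + d + r) / 2 := by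
    rw [abs_lt]
    constructor <;> linarith
  have hν : 0 < (a + d + r) / 2 := by linarith
  have h1 : |(a + d - r) / 2| * ((a + d + r) / 2) = 1 := by
    rw [← hdet, ← hprod, abs_mul, abs_of_pos hν]
  refine ⟨(a + d - r) / 2, (a + d + r) / 2, by ring, hprod, by linarith, by linarith, ?_, ?_⟩
  · nlinarith [abs_nonneg ((a + d - r) / 2)]
  · nlinarith [abs_nonneg ((a + d - r) / 2)]

/-- The bi-partition of which `(e, f)` is the given basis: its sides are the components of the
basis vectors along the eigenvectors, and these have the required signs by the
Perron–Frobenius property of the matrix. -/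
theorem exists_adapted_of_isGivenBy [DiscreteTopology L] [IsZLattice ℝ L]
    {b : Module.Basis (Fin 2) ℤ L} (hAF : A.IsGivenBy b M) (h01 : 0 < M 0 1) (h10 : 0 < M 1 0)
    (ht : 0 < M 0 0 + M 1 1) (hdet : |M.det| = 1) :
    ∃ (P : Bipartition L) (μ ν : ℝ), 0 < ν ∧ P.Adapted A μ ν M := by
  have hcpos : (0 : ℝ) < M 1 0 := by exact_mod_cast h10
  obtain ⟨μ, ν, hsum, hprod, hμa, hνa, hμ1, hν1⟩ := exists_eigenvalues
    (a := (M 0 0 : ℝ)) (b := (M 0 1 : ℝ)) (c := (M 1 0 : ℝ)) (d := (M 1 1 : ℝ))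
    (by exact_mod_cast h01) hcpos (by exact_mod_cast ht)
    (by rw [Matrix.det_fin_two] at hdet; exact_mod_cast hdet)
  have hδ : 0 < ν - μ := by linarith
  have hA0 : A.lin (b 0) = (M 0 0 : ℝ) • (b 0 : Plane) + (M 1 0 : ℝ) • (b 1 : Plane) := by
    rw [hAF 0, Fin.sum_univ_two, Int.cast_smul_eq_zsmul, Int.cast_smul_eq_zsmul]
  have hA1 : A.lin (b 1) = (M 0 1 : ℝ) • (b 0 : Plane) + (M 1 1 : ℝ) • (b 1 : Plane) := by
    rw [hAF 1, Fin.sum_univ_two, Int.cast_smul_eq_zsmul, Int.cast_smul_eq_zsmul]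
  have hind : ∀ x y : ℝ, x • (b 0 : Plane) + y • (b 1 : Plane) = 0 → x = 0 ∧ y = 0 := by
    have h := (b.ofZLatticeBasis ℝ L).linearIndependent
    intro x y hxy
    have := Fintype.linearIndependent_iff.1 h ![x, y] (by
      simpa [Fin.sum_univ_two, Module.Basis.ofZLatticeBasis_apply] using hxy)
    exact ⟨this 0, this 1⟩
  set v : Plane := (ν - M 0 0) • (b 0 : Plane) - (M 1 0 : ℝ) • (b 1 : Plane) with hv
  set w : Plane := (M 0 0 - μ) • (b 0 : Plane) + (M 1 0 : ℝ) • (b 1 : Plane) with hw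
  have hμ : (M 0 1 : ℝ) * M 1 0 = (M 0 0 - μ) * (M 1 1 - μ) := by
    linear_combination hprod - μ * hsum
  have hν : (M 0 1 : ℝ) * M 1 0 = (M 0 0 - ν) * (M 1 1 - ν) := by
    linear_combination hprod - ν * hsum
  have hAv : A.lin v = μ • v := by
    rw [hv, map_sub, map_smul, map_smul, hA0, hA1]
    have e1 : (ν - M 0 0) * M 0 0 - (M 1 0 : ℝ) * M 0 1 = μ * (ν - M 0 0) := by
      linear_combination (M 0 0 : ℝ) * hsum - hprod
    have e2 : (ν - M 0 0) * M 1 0 - (M 1 0 : ℝ) * M 1 1 = -(μ * M 1 0) := by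
      linear_combination (M 1 0 : ℝ) * hsum
    calc _ = ((ν - M 0 0) * M 0 0 - (M 1 0 : ℝ) * M 0 1) • (b 0 : Plane) +
          ((ν - M 0 0) * M 1 0 - (M 1 0 : ℝ) * M 1 1) • (b 1 : Plane) := by module
      _ = _ := by rw [e1, e2]; module
  have hAw : A.lin w = ν • w := by
    rw [hw, map_add, map_smul, map_smul, hA0, hA1]
    have e1 : (M 0 0 - μ) * M 0 0 + (M 1 0 : ℝ) * M 0 1 = ν * (M 0 0 - μ) := by
      linear_combination -(M 0 0 : ℝ) * hsum + hprod
    have e2 : (M 0 0 - μ) * M 1 0 + (M 1 0 : ℝ) * M 1 1 = ν * M 1 0 := by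
      linear_combination -(M 1 0 : ℝ) * hsum
    calc _ = ((M 0 0 - μ) * M 0 0 + (M 1 0 : ℝ) * M 0 1) • (b 0 : Plane) +
          ((M 0 0 - μ) * M 1 0 + (M 1 0 : ℝ) * M 1 1) • (b 1 : Plane) := by module
      _ = _ := by rw [e1, e2]; module
  have hvw : LinearIndependent ℝ ![v, w] := by
    rw [LinearIndependent.pair_iff]
    intro x y hxy
    obtain ⟨e1, e2⟩ := hind (x * (ν - M 0 0) + y * (M 0 0 - μ)) (y * M 1 0 - x * M 1 0) (by
      rw [← hxy, hv, hw]; module)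
    have hyx : y = x := mul_right_cancel₀ hcpos.ne' (by linarith)
    subst hyx
    have : y * (ν - μ) = 0 := by linarith
    have hy := (mul_eq_zero.1 this).resolve_right hδ.ne'
    exact ⟨hy, hy⟩
  have he : (1 / (ν - μ)) • v + (1 / (ν - μ)) • w = (b 0 : Plane) := by
    have : (1 / (ν - μ)) • v + (1 / (ν - μ)) • w = ((1 / (ν - μ)) * (ν - μ)) • (b 0 : Plane) := by
      rw [hv, hw]; module
    rw [this, one_div_mul_cancel hδ.ne', one_smul]
  have hf : -((M 0 0 - μ) / (M 1 0 * (ν - μ))) • v + ((ν - M 0 0) / (M 1 0 * (ν - μ))) • w =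
      (b 1 : Plane) := by
    have e1 : (M 0 0 - μ) / (M 1 0 * (ν - μ)) = (M 0 0 - μ) * (M 1 0 * (ν - μ))⁻¹ := rfl
    have e2 : (ν - M 0 0) / (M 1 0 * (ν - μ)) = (ν - M 0 0) * (M 1 0 * (ν - μ))⁻¹ := rfl
    have e3 : -((M 0 0 - μ) / (M 1 0 * (ν - μ))) • v + ((ν - M 0 0) / (M 1 0 * (ν - μ))) • w =
        ((M 1 0 * (ν - μ))⁻¹ * (M 1 0 * (ν - μ))) • (b 1 : Plane) := by
      rw [hv, hw, e1, e2]; module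
    rw [e3, inv_mul_cancel₀ (by positivity), one_smul]
  have hspan : Submodule.span ℤ {(b 0 : Plane), (b 1 : Plane)} = L := by
    have h := congrArg (Submodule.map L.subtype) b.span_eq
    rw [Submodule.map_span, Submodule.map_top, Submodule.range_subtype, ← Set.range_comp] at h
    refine Eq.trans ?_ h
    congr 1
    ext z
    simp [Fin.exists_fin_two, eq_comm]
  let P : Bipartition L :=
    { o := 0
      v := v
      w := w
      s := ![(M 0 0 - μ) / (M 1 0 * (ν - μ)), 1 / (ν - μ)]
      u := ![1 / (ν - μ), (ν - M 0 0) / (M 1 0 * (ν - μ))]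
      indep := hvw
      s_pos := by
        rw [Fin.forall_fin_two]
        exact ⟨div_pos (by linarith) (by positivity), by simpa using hδ⟩
      u_pos := by
        rw [Fin.forall_fin_two]
        exact ⟨by simpa using hδ, div_pos (by linarith) (by positivity)⟩
      span_eq := by
        simp only [Matrix.cons_val_zero, Matrix.cons_val_one, Matrix.cons_val_fin_one]
        rw [he, hf, hspan] }
  refine ⟨P, μ, ν, by linarith, hμ1, by rwa [abs_of_pos (by linarith)], hAv, hAw, fun m n => ?_,
    fun m n => ?_, Adapted.surj_of_eigen hAv hAw⟩
  · simp only [latX, P, Matrix.cons_val_zero, Matrix.cons_val_one, Matrix.cons_val_fin_one]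
    push_cast
    field_simp
    linear_combination (n : ℝ) * hμ
  · simp only [latY, P, Matrix.cons_val_zero, Matrix.cons_val_one, Matrix.cons_val_fin_one]
    push_cast
    field_simp
    linear_combination (n : ℝ) * hν

end Bipartition

/-! ### Classes of Berg partitions with a prescribed connectivity matrix -/

theorem ToralAut.ext_lin {L : Submodule ℤ Plane} {A B : ToralAut L} (h : A.lin = B.lin) :
    A = B := by
  cases A
  cases B
  cases h
  rfl

theorem ToralAut.neg_neg_eq {L : Submodule ℤ Plane} (A : ToralAut L) : -(-A) = A :=
  ToralAut.ext_lin (LinearEquiv.ext fun x => neg_neg (A.lin x))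

/-- A hyperbolic automorphism has no nonzero vector that it fixes or reverses. -/
theorem ToralAut.IsHyperbolic.eq_zero {L : Submodule ℤ Plane} {A : ToralAut L}
    (hA : A.IsHyperbolic) {x : Plane} {r : ℝ} (hr : |r| = 1) (h : A.lin x = r • x) : x = 0 := by
  by_contra hx
  have h1 : Module.End.HasEigenvalue (A.lin : Plane →ₗ[ℝ] Plane) r :=
    Module.End.hasEigenvalue_of_hasEigenvector
      ⟨Module.End.mem_eigenspace_iff.2 h, hx⟩
  rw [Module.End.hasEigenvalue_iff_isRoot_charpoly] at h1
  refine hA (algebraMap ℝ ℂ r) (h1.map) ?_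
  simpa using hr

namespace BergPartition

open Bipartition

variable {L : Submodule ℤ Plane} {A : ToralAut L} {μ ν : ℝ} {F : Matrix (Fin 2) (Fin 2) ℤ}

theorem exists_adapted (P : BergPartition A F.transpose) :
    ∃ μ ν M, P.1.Adapted A μ ν M ∧ ((0 < ν ∧ M = F) ∨ (ν < 0 ∧ M = -F)) := by
  obtain ⟨μ, ν, M, h⟩ := P.2.1.exists_adapted
  obtain ⟨m, n, hB⟩ := h.isBerg_iff.1 P.2.1
  refine ⟨μ, ν, M, h, ?_⟩
  rcases lt_or_gt_of_ne h.ν_ne with hν | hν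
  · refine Or.inr ⟨hν, ?_⟩
    ext i j
    have := ((hB.connectivity_eq h j i).2 hν).2
    rw [P.2.2, Matrix.transpose_apply] at this
    rw [Matrix.neg_apply, this, neg_neg]
  · refine Or.inl ⟨hν, ?_⟩
    ext i j
    have := ((hB.connectivity_eq h j i).1 hν).2
    rw [P.2.2, Matrix.transpose_apply] at this
    exact this.symm

/-- All Berg partitions with the same connectivity matrix have the same matrix. -/
theorem adapted_of_adapted {Q : Bipartition L} {M : Matrix (Fin 2) (Fin 2) ℤ}
    (hQ : Q.Adapted A μ ν M) (hM : (0 < ν ∧ M = F) ∨ (ν < 0 ∧ M = -F))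
    (P : BergPartition A F.transpose) : P.1.Adapted A μ ν M := by
  obtain ⟨μ', ν', M', h, h'⟩ := P.exists_adapted
  obtain ⟨rfl, rfl⟩ := hQ.eigen_eq h
  have : M = M' := by
    rcases hM with ⟨h1, rfl⟩ | ⟨h1, rfl⟩ <;> rcases h' with ⟨h2, rfl⟩ | ⟨h2, rfl⟩
    · rfl
    · exact absurd h1 h2.not_gt
    · exact absurd h1 h2.not_gt
    · rfl
  exact this ▸ h

theorem exists_bergAt (P : BergPartition A F.transpose) {M : Matrix (Fin 2) (Fin 2) ℤ}
    (hP : P.1.Adapted A μ ν M) : ∃ m n, P.1.BergAt A μ ν m n :=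
  hP.isBerg_iff.1 P.2.1

theorem connectivity_of_bergAt (hF : ∀ i j, 0 ≤ F i j) {Q : Bipartition L}
    {M : Matrix (Fin 2) (Fin 2) ℤ} (hQ : Q.Adapted A μ ν M) (hM : M = F ∨ M = -F) {m n : ℤ}
    (hB : Q.BergAt A μ ν m n) (i j : Fin 2) :
    (Q.connectivity A i j : ℤ) = F.transpose i j := by
  have h1 : (Q.connectivity A i j : ℤ) = |M j i| := by
    rcases lt_or_gt_of_ne hQ.ν_ne with hν | hν
    · have := (hB.connectivity_eq hQ i j).2 hν
      rw [abs_of_nonpos this.1, this.2]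
    · have := (hB.connectivity_eq hQ i j).1 hν
      rw [abs_of_nonneg this.1, this.2]
  rw [h1, Matrix.transpose_apply, ← abs_of_nonneg (hF j i)]
  rcases hM with rfl | rfl
  · rfl
  · rw [Matrix.neg_apply, abs_neg]

theorem equiv_iff {M : Matrix (Fin 2) (Fin 2) ℤ} {P Q : BergPartition A F.transpose}
    (hP : P.1.Adapted A μ ν M) (hQ : Q.1.Adapted A μ ν M) {m n m' n' : ℤ}
    (hPB : P.1.BergAt A μ ν m n) (hQB : Q.1.BergAt A μ ν m' n') :
    P.toClass = Q.toClass ↔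
      (m = m' ∧ n = n') ∨ (m + m' = M 0 0 + M 0 1 - 1 ∧ n + n' = M 1 0 + M 1 1 - 1) := by
  rw [toClass, toClass, Quotient.eq]
  constructor
  · exact eq_or_reflect_of_bergEquiv hP hQ hPB hQB
  · rintro (⟨rfl, rfl⟩ | ⟨h1, h2⟩)
    · exact bergEquiv_of_eq hP hQ hPB hQB
    · exact bergEquiv_of_reflect hP hQ hPB hQB h1 h2

/-- The translate of a Berg partition for `A` by a fixed point of `A ∘ S_P`, as a Berg partition
for `-A`. -/
theorem exists_translate (hF : ∀ i j, 0 ≤ F i j) (P : BergPartition A F.transpose) :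
    ∃ q : Plane, L.mkQ q ∈ P.1.spineU ∧ A.toTorus (P.1.rot (L.mkQ q)) = L.mkQ q ∧
      ∃ Q : BergPartition (-A) F.transpose, Q.1 = P.1.translate (-q) := by
  obtain ⟨μ, ν, M, hP, hM⟩ := P.exists_adapted
  obtain ⟨m, n, hB⟩ := P.exists_bergAt hP
  obtain ⟨q, h1, h2⟩ := exists_rot_fixed hP hB
  have hQ : (P.1.translate (-q)).Adapted (-A) (-μ) (-ν) (-M) := (hP.move _).neg
  have hQB := hB.translate hP h2
  refine ⟨q, h1, h2, ⟨P.1.translate (-q), hQ.isBerg_iff.2 ⟨_, _, hQB⟩,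
    connectivity_of_bergAt hF hQ ?_ hQB⟩, rfl⟩
  rcases hM with ⟨-, rfl⟩ | ⟨-, rfl⟩
  · exact Or.inr rfl
  · exact Or.inl (neg_neg _)

theorem exists_classEquiv_neg (hF : ∀ i j, 0 ≤ F i j) :
    ∃ Φ : BergClass A F.transpose ≃ BergClass (-A) F.transpose,
      ∀ P : BergPartition A F.transpose, ∃ q : Plane,
        L.mkQ q ∈ P.1.spineU ∧ A.toTorus (P.1.rot (L.mkQ q)) = L.mkQ q ∧
        ∃ Q : BergPartition (-A) F.transpose,
          Q.1 = P.1.translate (-q) ∧ Φ P.toClass = Q.toClass := by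
  choose q hq1 hq2 φ hφ using exists_translate (A := A) hF
  -- in terms of displacements, `φ` is the translation by the image of `-(e + f)`
  have hφB : ∀ (P : BergPartition A F.transpose) {μ ν : ℝ} {M : Matrix (Fin 2) (Fin 2) ℤ}
      {m n : ℤ}, P.1.Adapted A μ ν M → P.1.BergAt A μ ν m n →
      (φ P).1.Adapted (-A) (-μ) (-ν) (-M) ∧
        (φ P).1.BergAt (-A) (-μ) (-ν) (m - (M 0 0 + M 0 1)) (n - (M 1 0 + M 1 1)) := by
    intro P μ ν M m n hP hB
    rw [hφ]
    exact ⟨(hP.move _).neg, hB.translate hP (hq2 P)⟩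
  have hiff : ∀ P P' : BergPartition A F.transpose,
      P.toClass = P'.toClass ↔ (φ P).toClass = (φ P').toClass := by
    intro P P'
    obtain ⟨μ, ν, M, hP, hM⟩ := P.exists_adapted
    have hP' := adapted_of_adapted hP hM P'
    obtain ⟨m, n, hB⟩ := P.exists_bergAt hP
    obtain ⟨m', n', hB'⟩ := P'.exists_bergAt hP'
    obtain ⟨h1, h2⟩ := hφB P hP hB
    obtain ⟨h1', h2'⟩ := hφB P' hP' hB'
    rw [equiv_iff hP hP' hB hB', equiv_iff h1 h1' h2 h2']
    simp only [Matrix.neg_apply]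
    omega
  let ψ : BergClass A F.transpose → BergClass (-A) F.transpose :=
    Quotient.lift (fun P => (φ P).toClass) fun P P' h => (hiff P P').1 (Quotient.sound h)
  have hψ : ∀ P : BergPartition A F.transpose, ψ P.toClass = (φ P).toClass := fun P => rfl
  refine ⟨Equiv.ofBijective ψ ⟨?_, ?_⟩, fun P => ⟨q P, hq1 P, hq2 P, φ P, hφ P, rfl⟩⟩
  · intro x y
    obtain ⟨P, rfl⟩ := Quotient.exists_rep x
    obtain ⟨P', rfl⟩ := Quotient.exists_rep y
    exact fun h => (hiff P P').2 h
  · intro y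
    obtain ⟨Q, rfl⟩ := Quotient.exists_rep y
    obtain ⟨μ, ν, M, hQ, hM⟩ := exists_adapted Q
    obtain ⟨m, n, hB⟩ := exists_bergAt Q hQ
    obtain ⟨q', -, h2, R, hR⟩ := exists_translate hF Q
    have hRA : R.1.Adapted (-(-A)) (-μ) (-ν) (-M) := by rw [hR]; exact (hQ.move _).neg
    have hRB := hB.translate hQ h2
    rw [← hR] at hRB
    obtain ⟨P, hPA, hPB⟩ : ∃ P : BergPartition A F.transpose, P.1.Adapted A (-μ) (-ν) (-M) ∧
        P.1.BergAt A (-μ) (-ν) (m - (M 0 0 + M 0 1)) (n - (M 1 0 + M 1 1)) := by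
      rw [← A.neg_neg_eq]
      exact ⟨R, hRA, hRB⟩
    obtain ⟨h3, h4⟩ := hφB P hPA hPB
    simp only [neg_neg, Matrix.neg_apply] at h3 h4
    exact ⟨P.toClass, (equiv_iff h3 hQ h4 hB).2 (by omega)⟩

/-- If the matrix of `A` is non-negative, the classes correspond to the pairs of opposite levels
among `0, …, σ - 2`. -/
theorem card_class [DiscreteTopology L] [IsZLattice ℝ L] {b : Module.Basis (Fin 2) ℤ L}
    (hF : ∀ i j, 0 ≤ F i j) (hAF : A.IsGivenBy b F) (h01 : 0 < F 0 1) (h10 : 0 < F 1 0)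
    (ht : 0 < F 0 0 + F 1 1) (hdet : |F.det| = 1) :
    (Nat.card (BergClass A F.transpose) : ℤ) = (∑ i, ∑ j, F i j) / 2 := by
  obtain ⟨R, μ, ν, hν, hR⟩ := exists_adapted_of_isGivenBy hAF h01 h10 ht hdet
  have hPA : ∀ P : BergPartition A F.transpose, P.1.Adapted A μ ν F := fun P =>
    adapted_of_adapted hR (Or.inl ⟨hν, rfl⟩) P
  choose m n hB using fun P => exists_bergAt P (hPA P)
  set σ := F 0 0 + F 0 1 + F 1 0 + F 1 1 with hσ
  have hσ2 : ∑ i, ∑ j, F i j = σ := by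
    simp only [Fin.sum_univ_two]
    ring
  have hlo : ∀ P, 0 ≤ m P + n P := fun P => (hPA P).level_nonneg hν (hB P).adm
  have hhi : ∀ P, m P + n P ≤ σ - 2 := fun P => (hPA P).level_le hν (hB P).adm
  let g : BergPartition A F.transpose → ℤ := fun P => min (m P + n P) (σ - 2 - (m P + n P))
  have hg : ∀ P Q, P.toClass = Q.toClass ↔ g P = g Q := by
    intro P Q
    rw [equiv_iff (hPA P) (hPA Q) (hB P) (hB Q)]
    have hQ := (hPA P).admissible_congr (hPA Q) (hB Q).adm
    have e1 := (hPA P).eq_of_level_eq (hB P).adm hQ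
    have e2 := (hPA P).eq_of_level_eq (hB P).adm ((hPA P).adm_reflect hQ)
    simp only [g]
    omega
  let f : BergClass A F.transpose → Set.Ico 0 (σ / 2) :=
    Quotient.lift
      (fun P => ⟨g P, by
        have := hlo P
        have := hhi P
        simp only [g, Set.mem_Ico]
        omega⟩)
      fun P Q h => Subtype.ext ((hg P Q).1 (Quotient.sound h))
  have hf : Function.Bijective f := by
    constructor
    · intro x y
      obtain ⟨P, rfl⟩ := Quotient.exists_rep x
      obtain ⟨Q, rfl⟩ := Quotient.exists_rep y
      exact fun h => (hg P Q).2 (congrArg Subtype.val h)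
    · rintro ⟨i, hi0, hi1⟩
      obtain ⟨k, l, hkl, hadm⟩ := hR.exists_level hν hi0 (by omega)
      obtain ⟨Q, hQ, hQB⟩ := hR.exists_bergAt hadm
      let P : BergPartition A F.transpose :=
        ⟨Q, hQ.isBerg_iff.2 ⟨_, _, hQB⟩, connectivity_of_bergAt hF hQ (Or.inl rfl) hQB⟩
      refine ⟨P.toClass, Subtype.ext ?_⟩
      change g P = i
      have : m P = k ∧ n P = l := by
        refine (hPA P).latX_inj ((hPA P).point_left_inj (y := 0) ?_)
        rw [← (hB P).disp]
        exact hQB.disp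
      simp only [g, this.1, this.2]
      omega
  rw [Nat.card_congr (Equiv.ofBijective f hf), hσ2, Nat.card_eq_fintype_card, Fintype.card_ofFinset,
    Int.card_Ico, sub_zero, Int.toNat_of_nonneg]
  have := hF 0 0
  have := hF 1 1
  omega

end BergPartition

theorem theorem1 (L : Submodule ℤ Plane) [DiscreteTopology L] [IsZLattice ℝ L]
    (A : ToralAut L) (hA : A.IsHyperbolic)
    (b : Module.Basis (Fin 2) ℤ L) (F : GL (Fin 2) ℤ) (hF : ∀ i j, 0 ≤ F.1 i j)
    (hAF : A.IsGivenBy b F.1 ∨ A.IsGivenBy b (-F.1)) :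
    (Nat.card (BergClass A F.1.transpose) : ℤ) = (∑ i, ∑ j, F.1 i j) / 2 ∧
    ∃ Φ : BergClass A F.1.transpose ≃ BergClass (-A) F.1.transpose,
      ∀ P : BergPartition A F.1.transpose, ∃ q : Plane,
        L.mkQ q ∈ P.1.spineU ∧ A.toTorus (P.1.rot (L.mkQ q)) = L.mkQ q ∧
        ∃ Q : BergPartition (-A) F.1.transpose,
          Q.1 = P.1.translate (-q) ∧ Φ P.toClass = Q.toClass := by
  obtain ⟨Φ, hΦ⟩ := BergPartition.exists_classEquiv_neg (A := A) hF
  refine ⟨?_, Φ, hΦ⟩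
  have hdet : |F.1.det| = 1 :=
    Int.isUnit_iff_abs_eq.1 ((Matrix.isUnit_iff_isUnit_det _).1 F.isUnit)
  -- `ε` is the sign with which the matrix `F` represents `A`
  obtain ⟨ε, hε, hb⟩ : ∃ ε : ℝ, |ε| = 1 ∧ ∀ j, A.lin (b j) =
      ε • ((F.1 0 j : ℝ) • (b 0 : Plane) + (F.1 1 j : ℝ) • (b 1 : Plane)) := by
    rcases hAF with h | h
    · refine ⟨1, by simp, fun j => ?_⟩
      rw [h j, Fin.sum_univ_two]
      simp only [← Int.cast_smul_eq_zsmul ℝ]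
      module
    · refine ⟨-1, by simp, fun j => ?_⟩
      rw [h j, Fin.sum_univ_two]
      simp only [← Int.cast_smul_eq_zsmul ℝ, Matrix.neg_apply]
      push_cast
      module
  have hb0 : ∀ j, (b j : Plane) ≠ 0 := fun j h => b.ne_zero j (Subtype.ext h)
  have hmul : F.1 0 0 * F.1 1 1 - F.1 0 1 * F.1 1 0 = 1 ∨
      F.1 0 0 * F.1 1 1 - F.1 0 1 * F.1 1 0 = -1 := by
    rw [← Matrix.det_fin_two]
    exact (abs_eq zero_le_one).1 hdet
  -- a triangular matrix or a matrix of trace zero would have an eigenvalue `1` or `-1`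
  have hdiag : F.1 0 1 * F.1 1 0 = 0 → F.1 0 0 = 1 ∧ F.1 1 1 = 1 := by
    intro h
    have h1 : F.1 0 0 * F.1 1 1 = 1 := by
      have := mul_nonneg (hF 0 0) (hF 1 1)
      omega
    exact ⟨Int.eq_one_of_mul_eq_one_right (hF 0 0) h1, Int.eq_one_of_mul_eq_one_left (hF 1 1) h1⟩
  have h01 : 0 < F.1 0 1 := by
    refine lt_of_le_of_ne (hF 0 1) fun h => hb0 1 (hA.eq_zero hε ?_)
    rw [hb, ← h, (hdiag (by rw [← h, zero_mul])).2]
    simp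
  have h10 : 0 < F.1 1 0 := by
    refine lt_of_le_of_ne (hF 1 0) fun h => hb0 0 (hA.eq_zero hε ?_)
    rw [hb, ← h, (hdiag (by rw [← h, mul_zero])).1]
    simp
  have ht : 0 < F.1 0 0 + F.1 1 1 := by
    refine lt_of_le_of_ne (add_nonneg (hF 0 0) (hF 1 1)) fun h => ?_
    have h00 : F.1 0 0 = 0 := by linarith [hF 0 0, hF 1 1]
    have h11 : F.1 1 1 = 0 := by linarith [hF 0 0, hF 1 1]
    have h1 : F.1 0 1 * F.1 1 0 = 1 := by
      rw [h00, zero_mul, zero_sub] at hmul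
      have := mul_pos h01 h10
      omega
    have e1 := Int.eq_one_of_mul_eq_one_right (hF 0 1) h1
    have e2 := Int.eq_one_of_mul_eq_one_left (hF 1 0) h1
    have hz : (b 0 : Plane) + (b 1 : Plane) = 0 := hA.eq_zero hε (by
      rw [map_add, hb, hb, h00, h11, e1, e2]
      push_cast
      module)
    have hz' : b 0 + b 1 = 0 := Subtype.ext hz
    have := Fintype.linearIndependent_iff.1 b.linearIndependent ![1, 1] (by
      simpa [Fin.sum_univ_two] using hz') 0
    simp at this
  rcases hAF with h | h
  · exact BergPartition.card_class hF h h01 h10 ht hdet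
  · rw [Nat.card_congr Φ]
    refine BergPartition.card_class (b := b) hF (fun j => ?_) h01 h10 ht hdet
    rw [ToralAut.neg_lin_apply, h j]
    simp
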